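/- Let $(M,d_M)$ be a proper metric space (every closed ball is compact). Let $\mathbb{T}$ be the collection of measured, rooted spatial trees $\underline{\mathcal{T}}=(\mathcal{T},d_{\mathcal{T}},\mu_{\mathcal{T}},\phi_{\mathcal{T}},\rho_{\mathcal{T}})$, where $(\mathcal{T},d_{\mathcal{T}})$ is a complete and locally compact real tree, $\mu_{\mathcal{T}}$ is a locally finite Borel measure on $\mathcal{T}$, $\phi_{\mathcal{T}}:\mathcal{T}\to M$ is continuous and $\rho_{\mathcal{T}}\in\mathcal{T}$ (the root). Two elements are identified if there is a surjective isometry between them that preserves the measures, the maps into $M$ and the roots. (A real tree is a metric space in which any two points $a,b$ are joined by a unique isometric image of $[0,d(a,b)]$, and this image is also the range of every injective continuous path from $a$ to $b$.) For $r\ge 0$ let $\mathcal{T}^{(r)}$ be the closed ball of radius $r$ around $\rho_{\mathcal{T}}$, and let $\underline{\mathcal{T}}^{(r)}$ be obtained from $\underline{\mathcal{T}}$ by restricting the metric, the measure and the map to $\mathcal{T}^{(r)}$, with the same root. For compact $\underline{\mathcal{T}},\underline{\mathcal{T}}'\in\mathbb{T}$ let \[\Delta_c(\underline{\mathcal{T}},\underline{\mathcal{T}}')=\inf_{Z,\psi,\psi',\mathcal{C}}\Big\{d_P^Z\big(\mu_{\mathcal{T}}\circ\psi^{-1},\mu_{\mathcal{T}'}\circ\psi'^{-1}\big)+\sup_{(x,x')\in\mathcal{C}}\big(d_Z(\psi(x),\psi'(x'))+d_M(\phi_{\mathcal{T}}(x),\phi_{\mathcal{T}'}(x'))\big)\Big\},\]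 where the infimum is over all metric spaces $Z$, isometric embeddings $\psi:\mathcal{T}\to Z$, $\psi':\mathcal{T}'\to Z$, and correspondences $\mathcal{C}\subseteq\mathcal{T}\times\mathcal{T}'$ (sets whose projections to both factors are onto) with $(\rho_{\mathcal{T}},\rho_{\mathcal{T}'})\in\mathcal{C}$, and $d_P^Z$ is the Prohorov distance between finite Borel measures on $Z$. For $\underline{\mathcal{T}},\underline{\mathcal{T}}'\in\mathbb{T}$ let \[\Delta(\underline{\mathcal{T}},\underline{\mathcal{T}}')=\int_0^\infty e^{-r}\big(1\wedge\Delta_c(\underline{\mathcal{T}}^{(r)},\underline{\mathcal{T}}'^{(r)})\big)\,dr .\] Let $\mathcal{A}\subseteq\mathbb{T}$ be such that, for every $r>0$: (i) for every $\varepsilon>0$ there is a finite integer $N(r,\varepsilon)$ such that for every $\underline{\mathcal{T}}\in\mathcal{A}$ there is an $\varepsilon$-cover of $\mathcal{T}^{(r)}$ (a finite set of points such that every point of $\mathcal{T}^{(r)}$ is within distance $\varepsilon$ of one of them) of cardinality less than $N(r,\varepsilon)$; (ii) $\sup_{\underline{\mathcal{T}}\in\mathcal{A}}\mu_{\mathcal{T}}(\mathcal{T}^{(r)})<\infty$;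 (iii) $\{\phi_{\mathcal{T}}(\rho_{\mathcal{T}}):\underline{\mathcal{T}}\in\mathcal{A}\}$ is a bounded subset of $M$, and for every $\varepsilon>0$ there is a $\delta=\delta(r,\varepsilon)>0$ such that \[\sup_{\underline{\mathcal{T}}\in\mathcal{A}}\ \sup_{\substack{x,y\in\mathcal{T}^{(r)}:\\ d_{\mathcal{T}}(x,y)\le\delta}}d_M\big(\phi_{\mathcal{T}}(x),\phi_{\mathcal{T}}(y)\big)<\varepsilon .\] Then $\mathcal{A}$ is relatively compact in $\mathbb{T}$ with respect to the topology induced by $\Delta$, that is, its closure is compact. -/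

import Mathlib

open MeasureTheory Metric Set
open scoped ENNReal NNReal

universe u v

noncomputable section

/-- A metric space is a real tree if any two points `a`, `b` are joined by a unique isometric image
`f` of the interval `[0, dist a b]`, and every injective continuous path from `a` to `b` has the
same range as `f`. -/
def IsRealTree (X : Type u) [MetricSpace X] : Prop :=
  ∀ a b : X, ∃ f : Icc (0 : ℝ) (dist a b) → X,
    (Isometry f ∧ f ⟨0, left_mem_Icc.2 dist_nonneg⟩ = a ∧
      f ⟨dist a b, right_mem_Icc.2 dist_nonneg⟩ = b) ∧
    (∀ g : Icc (0 : ℝ) (dist a b) → X,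
      Isometry g → g ⟨0, left_mem_Icc.2 dist_nonneg⟩ = a →
        g ⟨dist a b, right_mem_Icc.2 dist_nonneg⟩ = b → g = f) ∧
    (∀ q : Icc (0 : ℝ) 1 → X,
      Continuous q → Function.Injective q → q 0 = a → q 1 = b → range q = range f)

/-- A quintuplet `(X, d, μ, φ, ρ)`: a metric space with a Borel measure, a map into `M` and a
root. The requirements on these data are imposed in `SpatialTree`. -/
structure RootedSpace (M : Type v) where
  /-- the underlying set -/
  X : Type u
  /-- the metric -/
  [metric : MetricSpace X]
  /-- the Borel sigma-algebra -/
  [meas : MeasurableSpace X]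
  [borel : BorelSpace X]
  /-- the measure -/
  μ : Measure X
  /-- the map into the image space -/
  φ : X → M
  /-- the root -/
  ρ : X

attribute [instance] RootedSpace.metric RootedSpace.meas RootedSpace.borel

/-- A measured, rooted spatial tree with image space `M`. -/
structure SpatialTree (M : Type v) [MetricSpace M] extends RootedSpace.{u, v} M where
  realTree : IsRealTree X
  complete : CompleteSpace X
  locallyCompact : LocallyCompactSpace X
  locallyFinite : IsLocallyFiniteMeasure μ
  continuous_φ : Continuous φ

namespace RootedSpace

variable {M : Type v}

/-- The closed ball of radius `r` around the root. -/
def rootBall (T : RootedSpace.{u, v} M) (r : ℝ) : Set T.X := closedBall T.ρ r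

/-- The restriction of all the data to the closed ball of radius `r` around the root. -/
def restrict (T : RootedSpace.{u, v} M) (r : ℝ≥0) : RootedSpace.{u, v} M where
  X := T.rootBall r
  μ := T.μ.comap Subtype.val
  φ := fun x => T.φ x
  ρ := ⟨T.ρ, mem_closedBall_self r.coe_nonneg⟩

/-- A correspondence between two sets. -/
def IsCorrespondence {X Y : Type u} (C : Set (X × Y)) : Prop :=
  (∀ x, ∃ y, (x, y) ∈ C) ∧ (∀ y, ∃ x, (x, y) ∈ C)

/-- The Prohorov distance between two Borel measures on a metric space, transported there from
measured spaces along the maps `ψ` and `ψ'`. -/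
def prohorovDist {X Y Z : Type u} [MeasurableSpace X] [MeasurableSpace Y] [MetricSpace Z]
    (μ : Measure X) (ν : Measure Y) (ψ : X → Z) (ψ' : Y → Z) : ℝ≥0∞ :=
  letI : MeasurableSpace Z := _root_.borel Z
  levyProkhorovEDist (μ.map ψ) (ν.map ψ')

/-- The distance `Δ_c`: the infimum, over all metric spaces `Z`, isometric embeddings `ψ`, `ψ'` into
`Z` and correspondences `C` containing the pair of roots, of the Prohorov distance of the image
measures plus the supremum over `C` of the distances in `Z` and in `M`. It is the distance of
the compact spatial trees, and is written here without using the tree property. -/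
def deltaC [MetricSpace M] (T T' : RootedSpace.{u, v} M) : ℝ≥0∞ :=
  ⨅ (Z : Type u) (_ : MetricSpace Z) (ψ : T.X → Z) (ψ' : T'.X → Z) (C : Set (T.X × T'.X))
    (_ : Isometry ψ) (_ : Isometry ψ') (_ : IsCorrespondence C) (_ : (T.ρ, T'.ρ) ∈ C),
    prohorovDist T.μ T'.μ ψ ψ' +
      ⨆ p ∈ C, (edist (ψ p.1) (ψ' p.2) + edist (T.φ p.1) (T'.φ p.2))

end RootedSpace

namespace SpatialTree

variable {M : Type v} [MetricSpace M]

/-- The distance `Δ(T, T') = ∫₀^∞ e^{-r} (1 ∧ Δ_c(T^{(r)}, T'^{(r)})) dr`, where `T^{(r)}` is the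
restriction of `T` to the closed ball of radius `r` around the root. It is at most `1`. -/
def delta (T T' : SpatialTree.{u, v} M) : ℝ≥0∞ :=
  ∫⁻ r in Ioi (0 : ℝ), ENNReal.ofReal (Real.exp (-r)) *
    min 1 ((T.restrict r.toNNReal).deltaC (T'.restrict r.toNNReal))

/-- The topology induced by `Δ`: a set is open if it contains a `Δ`-ball around each of its
points. -/
instance : TopologicalSpace (SpatialTree.{u, v} M) where
  IsOpen U := ∀ T ∈ U, ∃ ε : ℝ≥0∞, 0 < ε ∧ ∀ T', delta T T' < ε → T' ∈ U
  isOpen_univ := fun _ _ => ⟨1, one_pos, fun _ _ => mem_univ _⟩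
  isOpen_inter := fun U V hU hV T hT => by
    obtain ⟨a, ha, hUa⟩ := hU T hT.1
    obtain ⟨b, hb, hVb⟩ := hV T hT.2
    exact ⟨min a b, lt_min ha hb, fun T' h =>
      ⟨hUa T' (h.trans_le (min_le_left _ _)), hVb T' (h.trans_le (min_le_right _ _))⟩⟩
  isOpen_sUnion := fun S hS T ⟨U, hU, hT⟩ => by
    obtain ⟨a, ha, hUa⟩ := hS U hU T hT
    exact ⟨a, ha, fun T' h => ⟨U, hU, hUa T' h⟩⟩

/-- Two spatial trees are equivalent if there is a (surjective) isometry between them that preserves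
the measures, the maps into `M` and the roots. -/
def Equivalent (T T' : SpatialTree.{u, v} M) : Prop :=
  ∃ π : T.X ≃ᵢ T'.X, T.μ.map π = T'.μ ∧ (∀ x, T.φ x = T'.φ (π x)) ∧ π T.ρ = T'.ρ

/-- Equivalence of spatial trees is an equivalence relation. -/
instance setoid : Setoid (SpatialTree.{u, v} M) where
  r := Equivalent
  iseqv := {
    refl := fun T => ⟨IsometryEquiv.refl T.X, Measure.map_id, fun _ => rfl, rfl⟩
    symm := by
      rintro T T' ⟨π, hμ, hφ, hρ⟩
      refine ⟨π.symm, ?_, fun x => by simp [hφ], by simp [← hρ]⟩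
      rw [← hμ, Measure.map_map π.symm.continuous.measurable π.continuous.measurable]
      have h : ⇑π.symm ∘ ⇑π = id := funext π.symm_apply_apply
      rw [h, Measure.map_id]
    trans := by
      rintro T T' T'' ⟨π, hμ, hφ, hρ⟩ ⟨π', hμ', hφ', hρ'⟩
      refine ⟨π.trans π', ?_, fun x => by simp [hφ, hφ'], by simp [hρ, hρ']⟩
      rw [← hμ', ← hμ, Measure.map_map π'.continuous.measurable π.continuous.measurable]
      rfl }

end SpatialTree

/-- The space of equivalence classes of spatial trees. It carries the quotient topology, which is the
topology of the distance that `Δ` induces on the equivalence classes. -/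
abbrev SpatialTreeSpace (M : Type v) [MetricSpace M] : Type (max (u + 1) v) :=
  Quotient (SpatialTree.setoid.{u, v} (M := M))

end

/-!
The members of `A` obey common bounds: on the sizes of separated sets in the balls around the root,
on the masses of these balls, on the modulus of continuity of the map and on the image of the root.
Trees obeying fixed bounds form a closed set, and it is enough to find a limit for every ultrafilter
of such trees.

Number the points of finer and finer finite nets. The distances between the numbered points of the
trees are bounded, so they converge along the ultrafilter, and the completion of the limit
pseudometric is the limit space. A complete metric space is a real tree exactly when it satisfies
the four-point condition and contains, between any two points, points at every intermediate
distance; both properties pass to the limit. The maps into `M` converge at the numbered points and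
extend by equicontinuity, and the measures, pushed to the nets, have a vague limit. Gluing a tree to
the limit along a net shows that large balls are close in a common metric space. This makes `Δ_c`
small at every radius whose sphere carries no limit mass, hence at all but countably many radii, and
dominated convergence gives `Δ → 0`.
-/

noncomputable section

section joinAtZero

variable {X : Type u} {p q : ℝ → X} {r : ℝ}

/-- The path that follows `p` up to time `0` and `q` afterwards. -/
def joinAtZero (p q : ℝ → X) (r : ℝ) : X := if r ≤ 0 then p r else q r

theorem joinAtZero_of_nonpos (hr : r ≤ 0) : joinAtZero p q r = p r := if_pos hr

theorem joinAtZero_of_nonneg (h : p 0 = q 0) (hr : 0 ≤ r) : joinAtZero p q r = q r := by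
  rcases hr.eq_or_lt with rfl | hr
  · rw [joinAtZero_of_nonpos le_rfl, h]
  · exact if_neg hr.not_ge

theorem continuous_joinAtZero [TopologicalSpace X] (hp : Continuous p) (hq : Continuous q)
    (h : p 0 = q 0) : Continuous (joinAtZero p q) :=
  hp.if_le hq continuous_id continuous_const fun r hr => by rw [show r = 0 from hr, h]

end joinAtZero

section RealTree

variable {X : Type u} [MetricSpace X]

/-- The four-point condition, that is, `0`-hyperbolicity in the sense of Gromov. -/
def FourPoint (X : Type u) [PseudoMetricSpace X] : Prop :=
  ∀ x y z w : X, dist x y + dist z w ≤ max (dist x z + dist y w) (dist x w + dist y z)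

/-- Between any two points there are points at all intermediate distances. -/
def HasBetween (X : Type u) [PseudoMetricSpace X] : Prop :=
  ∀ a b : X, ∀ t ∈ Icc (0 : ℝ) (dist a b), ∃ z, dist a z = t ∧ dist z b = dist a b - t

/-- A unit speed geodesic from `a` to `b`. It is a function on all of `ℝ`, extended continuously
beyond `[0, dist a b]`, where its values are irrelevant. -/
structure IsGeodesic (γ : ℝ → X) (a b : X) : Prop where
  continuous : Continuous γ
  apply_zero : γ 0 = a
  apply_dist : γ (dist a b) = b
  dist_eq : ∀ s ∈ Icc 0 (dist a b), ∀ t ∈ Icc 0 (dist a b), dist (γ s) (γ t) = |s - t|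

namespace IsGeodesic

variable {γ : ℝ → X} {a b : X} {t : ℝ}

theorem dist_left (hγ : IsGeodesic γ a b) (ht : t ∈ Icc 0 (dist a b)) : dist a (γ t) = t := by
  have h := hγ.dist_eq 0 (left_mem_Icc.2 dist_nonneg) t ht
  rwa [hγ.apply_zero, zero_sub, abs_neg, abs_of_nonneg ht.1] at h

theorem dist_right (hγ : IsGeodesic γ a b) (ht : t ∈ Icc 0 (dist a b)) :
    dist (γ t) b = dist a b - t := by
  have h := hγ.dist_eq t ht _ (right_mem_Icc.2 dist_nonneg)
  rwa [hγ.apply_dist, abs_sub_comm, abs_of_nonneg (sub_nonneg.2 ht.2)] at h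

theorem injOn (hγ : IsGeodesic γ a b) : InjOn γ (Icc 0 (dist a b)) := fun s hs t ht h => by
  rw [← hγ.dist_left hs, h, hγ.dist_left ht]

theorem exists_isGreatest_eq {f g : ℝ → X} {x y z : X} (hf : IsGeodesic f x y)
    (hg : IsGeodesic g x z) :
    ∃ t, IsGreatest (Icc 0 (min (dist x y) (dist x z)) ∩ {t | f t = g t}) t :=
  (isCompact_Icc.inter_right (isClosed_eq hf.continuous hg.continuous)).exists_isGreatest
    ⟨0, ⟨le_rfl, le_min dist_nonneg dist_nonneg⟩, hf.apply_zero.trans hg.apply_zero.symm⟩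

theorem injOn_joinAtZero {f g : ℝ → X} {x y z : X} (hf : IsGeodesic f x y)
    (hg : IsGeodesic g x z) (ht : 0 ≤ t) (hfg : f t = g t)
    (htmax : t ∈ upperBounds (Icc 0 (min (dist x y) (dist x z)) ∩ {t | f t = g t})) :
    InjOn (joinAtZero (fun r => f (t - r)) (fun r => g (t + r)))
      (Icc (t - dist x y) (dist x z - t)) := by
  set p := joinAtZero (fun r => f (t - r)) (fun r => g (t + r))
  have p_nonpos : ∀ r ≤ 0, p r = f (t - r) := fun r hr => joinAtZero_of_nonpos hr
  have p_nonneg : ∀ r ≥ 0, p r = g (t + r) := fun r hr =>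
    joinAtZero_of_nonneg (by simpa using hfg) hr
  have dist_p : ∀ r ∈ Icc (t - dist x y) (dist x z - t), dist x (p r) = t + |r| := by
    rintro r ⟨hr, hr'⟩
    rcases le_total r 0 with h0 | h0
    · rw [p_nonpos r h0, hf.dist_left ⟨by linarith, by linarith⟩, abs_of_nonpos h0, sub_eq_add_neg]
    · rw [p_nonneg r h0, hg.dist_left ⟨by linarith, by linarith⟩, abs_of_nonneg h0]
  have eq_zero : ∀ r, 0 ≤ r → r ≤ dist x z - t → t - dist x y ≤ -r → p (-r) = p r → r = 0 := by
    intro r h0 hr hr' heq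
    rw [p_nonpos _ (neg_nonpos.2 h0), p_nonneg r h0, sub_neg_eq_add] at heq
    linarith [htmax ⟨⟨by linarith, le_min (by linarith) (by linarith)⟩, heq⟩]
  intro r hr s hs heq
  have habs : |r| = |s| := by linarith [dist_p r hr, dist_p s hs, congrArg (dist x) heq]
  rcases abs_eq_abs.1 habs with rfl | rfl
  · rfl
  · rcases le_total s 0 with h0 | h0
    · linarith [eq_zero (-s) (neg_nonneg.2 h0) hr.2 (by rw [neg_neg]; exact hs.1)
        (by rw [neg_neg, heq])]
    · linarith [eq_zero s h0 hs.2 hr.1 heq]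

end IsGeodesic

namespace IsRealTree

theorem exists_isGeodesic (h : IsRealTree X) (a b : X) : ∃ γ : ℝ → X, IsGeodesic γ a b := by
  obtain ⟨f, ⟨hf, h0, h1⟩, -, -⟩ := h a b
  refine ⟨IccExtend dist_nonneg f, hf.continuous.Icc_extend', ?_, ?_, fun s hs t ht => ?_⟩
  · rw [IccExtend_of_mem _ _ (left_mem_Icc.2 dist_nonneg), h0]
  · rw [IccExtend_of_mem _ _ (right_mem_Icc.2 dist_nonneg), h1]
  · rw [IccExtend_of_mem _ _ hs, IccExtend_of_mem _ _ ht, hf.dist_eq, Subtype.dist_eq,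
      Real.dist_eq]

theorem hasBetween (h : IsRealTree X) : HasBetween X := fun a b t ht =>
  have ⟨γ, hγ⟩ := h.exists_isGeodesic a b
  ⟨γ t, hγ.dist_left ht, hγ.dist_right ht⟩

theorem image_eq_image (h : IsRealTree X) {p q : ℝ → X} {α β α' β' : ℝ} (hαβ : α ≤ β)
    (hαβ' : α' ≤ β') (hp : ContinuousOn p (Icc α β)) (hq : ContinuousOn q (Icc α' β'))
    (hpi : InjOn p (Icc α β)) (hqi : InjOn q (Icc α' β')) (hleft : p α = q α')
    (hright : p β = q β') : p '' Icc α β = q '' Icc α' β' := by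
  have heq : α = β ↔ α' = β' := by
    rw [← hpi.eq_iff (left_mem_Icc.2 hαβ) (right_mem_Icc.2 hαβ), hleft, hright,
      hqi.eq_iff (left_mem_Icc.2 hαβ') (right_mem_Icc.2 hαβ')]
  rcases hαβ.eq_or_lt with rfl | hlt
  · obtain rfl := heq.1 rfl
    simp only [Icc_self, image_singleton, hleft]
  have hlt' : α' < β' := hαβ'.lt_of_ne fun e => hlt.ne (heq.2 e)
  obtain ⟨f, -, -, hf⟩ := h (p α) (p β)
  have image_eq_range : ∀ (r : ℝ → X) (c d : ℝ), c < d → ContinuousOn r (Icc c d) →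
      InjOn r (Icc c d) → r c = p α → r d = p β → r '' Icc c d = range f := by
    intro r c d hcd hrc hri hc hd
    have hrange := hf ((Icc c d).domRestrict r ∘ (iccHomeoI c d hcd).symm)
      (hrc.domRestrict.comp (iccHomeoI c d hcd).symm.continuous)
      (hri.injective.comp (iccHomeoI c d hcd).symm.injective)
      (by simp [iccHomeoI_symm_apply_coe, hc])
      (by simp [iccHomeoI_symm_apply_coe, hd])
    rwa [(iccHomeoI c d hcd).symm.surjective.range_comp, range_domRestrict] at hrange
  rw [image_eq_range p α β hlt hp hpi rfl rfl,
    image_eq_range q α' β' hlt' hq hqi hleft.symm hright.symm]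

theorem exists_median (h : IsRealTree X) (x y z : X) :
    ∃ c, dist x c + dist c y = dist x y ∧ dist x c + dist c z = dist x z ∧
      dist y c + dist c z = dist y z := by
  obtain ⟨f, hf⟩ := h.exists_isGeodesic x y
  obtain ⟨g, hg⟩ := h.exists_isGeodesic x z
  obtain ⟨k, hk⟩ := h.exists_isGeodesic y z
  obtain ⟨t, ⟨⟨ht, htm⟩, hfg : f t = g t⟩, htmax⟩ := hf.exists_isGreatest_eq hg
  obtain ⟨hty, htz⟩ := le_min_iff.1 htm
  set p := joinAtZero (fun r => f (t - r)) (fun r => g (t + r))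
  have hp0 : f (t - 0) = g (t + 0) := by rw [sub_zero, add_zero, hfg]
  have p_nonpos : ∀ r ≤ 0, p r = f (t - r) := fun r hr => joinAtZero_of_nonpos hr
  have p_nonneg : ∀ r ≥ 0, p r = g (t + r) := fun r hr => joinAtZero_of_nonneg hp0 hr
  have hp : Continuous p := continuous_joinAtZero (hf.continuous.comp (by fun_prop))
    (hg.continuous.comp (by fun_prop)) hp0
  have himage := h.image_eq_image (by linarith) dist_nonneg hp.continuousOn
    hk.continuous.continuousOn (hf.injOn_joinAtZero hg ht hfg htmax) hk.injOn
    (by rw [p_nonpos _ (by linarith), sub_sub_cancel, hf.apply_dist, hk.apply_zero])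
    (by rw [p_nonneg _ (by linarith), add_sub_cancel, hg.apply_dist, hk.apply_dist])
  obtain ⟨s, hs, hks⟩ : p 0 ∈ k '' Icc 0 (dist y z) := himage ▸
    mem_image_of_mem p ⟨by linarith, by linarith⟩
  rw [p_nonpos 0 le_rfl, sub_zero] at hks
  refine ⟨f t, ?_, ?_, ?_⟩
  · rw [hf.dist_left ⟨ht, hty⟩, hf.dist_right ⟨ht, hty⟩, add_sub_cancel]
  · rw [hfg, hg.dist_left ⟨ht, htz⟩, hg.dist_right ⟨ht, htz⟩, add_sub_cancel]
  · rw [← hks, hk.dist_left hs, hk.dist_right hs, add_sub_cancel]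

theorem apply_dist_of_mem_segment (h : IsRealTree X) {γ : ℝ → X} {a b p : X}
    (hγ : IsGeodesic γ a b) (hp : dist a p + dist p b = dist a b) : γ (dist a p) = p := by
  obtain ⟨f, hf⟩ := h.exists_isGeodesic a p
  obtain ⟨g, hg⟩ := h.exists_isGeodesic p b
  set q := joinAtZero (fun r => f (dist a p + r)) g
  have hq0 : f (dist a p + 0) = g 0 := by rw [add_zero, hf.apply_dist, hg.apply_zero]
  have q_nonpos : ∀ r ≤ 0, q r = f (dist a p + r) := fun r hr => joinAtZero_of_nonpos hr
  have q_nonneg : ∀ r ≥ 0, q r = g r := fun r hr => joinAtZero_of_nonneg hq0 hr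
  have hq : Continuous q :=
    continuous_joinAtZero (hf.continuous.comp (by fun_prop)) hg.continuous hq0
  have dist_q : ∀ r ∈ Icc (-dist a p) (dist p b), dist a (q r) = dist a p + r := by
    rintro r ⟨hr, hr'⟩
    rcases le_total r 0 with h0 | h0
    · rw [q_nonpos r h0, hf.dist_left ⟨by linarith, by linarith⟩]
    · rw [q_nonneg r h0]
      linarith [hg.dist_left ⟨h0, hr'⟩, hg.dist_right ⟨h0, hr'⟩, dist_triangle a p (g r),
        dist_triangle a (g r) b]
  have hqi : InjOn q (Icc (-dist a p) (dist p b)) := fun r hr s hs heq => by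
    linarith [dist_q r hr, dist_q s hs, congrArg (dist a) heq]
  have hle : -dist a p ≤ 0 ∧ 0 ≤ dist p b := ⟨neg_nonpos.2 dist_nonneg, dist_nonneg⟩
  have himage := h.image_eq_image (hle.1.trans hle.2) dist_nonneg hq.continuousOn
    hγ.continuous.continuousOn hqi hγ.injOn
    (by rw [q_nonpos _ hle.1, add_neg_cancel, hf.apply_zero, hγ.apply_zero])
    (by rw [q_nonneg _ hle.2, hg.apply_dist, hγ.apply_dist])
  obtain ⟨s, hs, hγs⟩ : q 0 ∈ γ '' Icc 0 (dist a b) := himage ▸ mem_image_of_mem q hle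
  rw [q_nonneg 0 le_rfl, hg.apply_zero] at hγs
  rw [← hγs, hγ.dist_left hs]

theorem eq_of_mem_segment (h : IsRealTree X) {a b p q : X}
    (hp : dist a p + dist p b = dist a b) (hq : dist a q + dist q b = dist a b)
    (heq : dist a p = dist a q) : p = q := by
  obtain ⟨γ, hγ⟩ := h.exists_isGeodesic a b
  rw [← h.apply_dist_of_mem_segment hγ hp, heq, h.apply_dist_of_mem_segment hγ hq]

theorem exists_mem_segment_inter (h : IsRealTree X) (w x z : X) {t : ℝ} (h0 : 0 ≤ t)
    (ht : t ≤ (dist w x + dist w z - dist x z) / 2) :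
    ∃ p, dist w p = t ∧ dist w p + dist p x = dist w x ∧ dist w p + dist p z = dist w z := by
  obtain ⟨c, hcx, hcz, hxz⟩ := h.exists_median w x z
  obtain ⟨p, hwp, hpc⟩ := h.hasBetween w c t ⟨h0, by linarith [dist_comm x c]⟩
  refine ⟨p, hwp, le_antisymm ?_ (dist_triangle _ _ _), le_antisymm ?_ (dist_triangle _ _ _)⟩
  · linarith [dist_triangle p c x]
  · linarith [dist_triangle p c z]

theorem fourPoint (h : IsRealTree X) : FourPoint X := by
  intro x y z w
  by_contra! hlt
  obtain ⟨hlt₁, hlt₂⟩ := max_lt_iff.1 hlt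
  -- the smaller of the Gromov products of `x, z` and of `y, z` at `w`
  set t := min ((dist w x + dist w z - dist x z) / 2) ((dist w y + dist w z - dist y z) / 2) with ht
  have ht0 : 0 ≤ t := le_min (by linarith [dist_triangle_left x z w])
    (by linarith [dist_triangle_left y z w])
  obtain ⟨p, hp, hpx, hpz⟩ := h.exists_mem_segment_inter w x z ht0 (min_le_left _ _)
  obtain ⟨q, hq, hqy, hqz⟩ := h.exists_mem_segment_inter w y z ht0 (min_le_right _ _)
  obtain rfl : p = q := h.eq_of_mem_segment hpz hqz (hp.trans hq.symm)
  have hxy : dist x y ≤ dist w x + dist w y - 2 * t := by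
    linarith [dist_triangle_left x y p]
  rcases min_choice ((dist w x + dist w z - dist x z) / 2)
      ((dist w y + dist w z - dist y z) / 2) with hm | hm <;>
  · rw [hm] at ht
    linarith [dist_comm w y, dist_comm w z, dist_comm w x]

end IsRealTree

namespace FourPoint

theorem dist_eq_of_mem_segment (h : FourPoint X) {a b p q : X}
    (hp : dist a p + dist p b = dist a b) (hq : dist a q + dist q b = dist a b) :
    dist p q = |dist a p - dist a q| := by
  refine le_antisymm ?_ (by simpa only [dist_comm a] using abs_dist_sub_le p q a)
  rcases le_max_iff.1 (h p q a b) with h' | h'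
  · linarith [dist_comm a p, le_abs_self (dist a p - dist a q)]
  · linarith [dist_comm a q, neg_abs_le (dist a p - dist a q)]

theorem mem_segment_of_dist_lt (h : FourPoint X) {a x y z : X}
    (hx : dist a z + dist z x = dist a x) (hy : dist y x < dist x z) :
    dist a z + dist z y = dist a y := by
  refine le_antisymm ?_ (dist_triangle a z y)
  rcases le_max_iff.1 (h a x z y) with h' | h' <;>
  linarith [dist_comm x y, dist_comm x z, dist_comm y z, dist_nonneg (x := z) (y := y)]

theorem segment_subset_of_isPreconnected (h : FourPoint X) {s : Set X} (hs : IsPreconnected s)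
    {a b z : X} (ha : a ∈ s) (hb : b ∈ s) (hz : dist a z + dist z b = dist a b) : z ∈ s := by
  by_contra hzs
  have ne_z : ∀ x ∈ s, x ≠ z := fun x hx e => hzs (e ▸ hx)
  -- the points whose segment to `a` avoids `z`, and the points other than `z` behind `z`
  set U : Set X := {x | dist a x < dist a z + dist z x}
  set V : Set X := {x | dist a z + dist z x = dist a x ∧ x ≠ z}
  have hU : IsOpen U := isOpen_lt (by fun_prop) (by fun_prop)
  have hV : IsOpen V := by
    refine Metric.isOpen_iff.2 fun x ⟨hx, hxz⟩ => ⟨dist x z, dist_pos.2 hxz, fun y hy => ?_⟩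
    refine ⟨h.mem_segment_of_dist_lt hx hy, ?_⟩
    rintro rfl
    exact (mem_ball'.1 hy).false
  have hUV : s ⊆ U ∪ V := fun x hx =>
    (dist_triangle a z x).lt_or_eq.imp id fun e => ⟨e.symm, ne_z x hx⟩
  have haU : a ∈ U := by
    rw [mem_ofPred_eq, dist_self, dist_comm z a]
    exact add_pos (dist_pos.2 (ne_z a ha)) (dist_pos.2 (ne_z a ha))
  obtain ⟨x, -, hxU, hxV⟩ := hs U V hU hV hUV ⟨a, ha, haU⟩ ⟨b, hb, hz, ne_z b hb⟩
  exact hxU.ne' hxV.1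

theorem exists_median (h : FourPoint X) (hX : HasBetween X) (x y z : X) :
    ∃ c, dist x c + dist c y = dist x y ∧ dist x c + dist c z = dist x z ∧
      dist y c + dist c z = dist y z := by
  -- the Gromov product of `y` and `z` at `x` is the distance from `x` to the median
  set t := (dist x y + dist x z - dist y z) / 2 with ht_def
  have ht : 0 ≤ t := by linarith [dist_triangle_left y z x]
  obtain ⟨c, hxc, hcy⟩ := hX x y t ⟨ht, by linarith [dist_triangle x y z]⟩
  obtain ⟨c', hxc', hcz⟩ := hX x z t
    ⟨ht, by linarith [dist_triangle x z y, dist_comm y z]⟩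
  have hyc' : dist y c' ≤ dist x y - t := by
    rcases le_max_iff.1 (h y c' x z) with h' | h' <;>
    linarith [dist_comm x y, dist_comm x c']
  have hcc' : dist c c' ≤ 0 := by
    rcases le_max_iff.1 (h c c' x y) with h' | h' <;>
    linarith [dist_comm c x, dist_comm c' x, dist_comm c' y]
  obtain rfl := dist_le_zero.1 hcc'
  exact ⟨c, by linarith, by linarith, by linarith [dist_comm c y]⟩

theorem mem_segment_of_injective (h : FourPoint X) (hX : HasBetween X) {q : Icc (0 : ℝ) 1 → X}
    (hq : Continuous q) (hqi : Function.Injective q) (s : Icc (0 : ℝ) 1) :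
    dist (q 0) (q s) + dist (q s) (q 1) = dist (q 0) (q 1) := by
  obtain ⟨c, h0, h1, h01⟩ := h.exists_median hX (q s) (q 0) (q 1)
  obtain ⟨u, hu, hqu⟩ : c ∈ q '' Iic s :=
    h.segment_subset_of_isPreconnected (isPreconnected_Iic.image _ hq.continuousOn)
      ⟨s, self_mem_Iic, rfl⟩ ⟨0, s.2.1, rfl⟩ h0
  obtain ⟨v, hv, hqv⟩ : c ∈ q '' Ici s :=
    h.segment_subset_of_isPreconnected (isPreconnected_Ici.image _ hq.continuousOn)
      ⟨s, self_mem_Ici, rfl⟩ ⟨1, s.2.2, rfl⟩ h1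
  obtain rfl : u = v := hqi (hqu.trans hqv.symm)
  obtain rfl : u = s := le_antisymm hu hv
  rwa [hqu]

theorem isRealTree (h : FourPoint X) (hX : HasBetween X) : IsRealTree X := by
  intro a b
  choose γ hγa hγb using fun t : Icc 0 (dist a b) => hX a b t t.2
  have hγ : ∀ t, dist a (γ t) + dist (γ t) b = dist a b := fun t => by
    rw [hγa, hγb, add_sub_cancel]
  have eq_γ : ∀ (z : X) (t : Icc 0 (dist a b)), dist a z + dist z b = dist a b →
      dist a z = t → z = γ t := by
    intro z t hz hzt
    rw [← dist_eq_zero, h.dist_eq_of_mem_segment hz (hγ t), hzt, hγa, sub_self, abs_zero]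
  refine ⟨γ, ⟨.of_dist_eq fun s t => ?_, ?_, ?_⟩, fun g hg hg0 hg1 => funext fun t => ?_,
    fun q hq hqi hq0 hq1 => Subset.antisymm ?_ ?_⟩
  · rw [h.dist_eq_of_mem_segment (hγ s) (hγ t), hγa, hγa, Subtype.dist_eq, Real.dist_eq]
  · exact (dist_eq_zero.1 (hγa _)).symm
  · exact dist_eq_zero.1 ((hγb _).trans (sub_self _))
  · have hgt : dist a (g t) = t := by
      have e := hg.dist_eq ⟨0, left_mem_Icc.2 dist_nonneg⟩ t
      rwa [hg0, Subtype.dist_eq, Real.dist_eq, zero_sub, abs_neg, abs_of_nonneg t.2.1] at e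
    have hgb : dist (g t) b = dist a b - t := by
      have e := hg.dist_eq t ⟨dist a b, right_mem_Icc.2 dist_nonneg⟩
      rwa [hg1, Subtype.dist_eq, dist_comm (t : ℝ), Real.dist_eq,
        abs_of_nonneg (sub_nonneg.2 t.2.2)] at e
    exact eq_γ _ _ (by rw [hgt, hgb, add_sub_cancel]) hgt
  · rintro _ ⟨s, rfl⟩
    have hs := h.mem_segment_of_injective hX hq hqi s
    rw [hq0, hq1] at hs
    have hmem : dist a (q s) ≤ dist a b := by linarith [dist_nonneg (x := q s) (y := b)]
    exact ⟨⟨dist a (q s), dist_nonneg, hmem⟩, (eq_γ _ _ hs rfl).symm⟩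
  · rintro _ ⟨t, rfl⟩
    exact h.segment_subset_of_isPreconnected (isPreconnected_range hq) ⟨0, hq0⟩ ⟨1, hq1⟩ (hγ t)

end FourPoint

end RealTree

section Vague

open Filter Topology CompactlySupported

variable {ι X : Type*} [TopologicalSpace X]

theorem exists_tendsto_of_eventually_mem_isCompact (G : Ultrafilter ι) {f : ι → X} {s : Set X}
    (hs : IsCompact s) (hf : ∀ᶠ k in G, f k ∈ s) : ∃ y ∈ s, Tendsto f G (𝓝 y) :=
  hs.ultrafilter_le_nhds (G.map f) (le_principal_iff.2 hf)

variable [MeasurableSpace X]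

/-- Vague convergence of measures along a filter: the integrals of all compactly supported
continuous functions converge. -/
def TendstoVague (ν : ι → Measure X) (l : Filter ι) (μ : Measure X) : Prop :=
  ∀ g : C_c(X, ℝ), Tendsto (fun k => ∫ x, g x ∂ν k) l (𝓝 (∫ x, g x ∂μ))

theorem exists_norm_integral_le_mul_measureReal_tsupport (g : C_c(X, ℝ)) :
    ∃ B : ℝ≥0, ∀ ν : Measure X, ν (tsupport g) < ∞ →
      ‖∫ x, g x ∂ν‖ ≤ B * ν.real (tsupport g) := by
  obtain ⟨B, hB⟩ := g.hasCompactSupport.exists_bound_of_continuous g.continuous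
  refine ⟨B.toNNReal, fun ν hν => ?_⟩
  rw [← setIntegral_eq_integral_of_forall_compl_eq_zero (s := tsupport g)
    fun x hx => image_eq_zero_of_notMem_tsupport hx]
  exact norm_setIntegral_le_of_norm_le_const hν fun x _ => (hB x).trans B.le_coe_toNNReal

variable [BorelSpace X] [T2Space X] [LocallyCompactSpace X]

theorem exists_tendstoVague (G : Ultrafilter ι) (ν : ι → Measure X)
    [∀ k, IsFiniteMeasureOnCompacts (ν k)]
    (hν : ∀ K : Set X, IsCompact K → ∃ C : ℝ≥0, ∀ᶠ k in G, ν k K ≤ C) :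
    ∃ μ : Measure X, IsFiniteMeasureOnCompacts μ ∧ TendstoVague ν G μ := by
  have hint : ∀ (g : C_c(X, ℝ)) k, Integrable g (ν k) := fun g k =>
    g.continuous.integrable_of_hasCompactSupport g.hasCompactSupport
  have exists_limit : ∀ g : C_c(X, ℝ), ∃ a, Tendsto (fun k => ∫ x, g x ∂ν k) G (𝓝 a) := by
    intro g
    obtain ⟨B, hB⟩ := exists_norm_integral_le_mul_measureReal_tsupport g
    obtain ⟨C, hC⟩ := hν _ g.hasCompactSupport
    have hmem : ∀ᶠ k in G, ∫ x, g x ∂ν k ∈ closedBall (0 : ℝ) (B * C) := by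
      filter_upwards [hC] with k hk
      rw [mem_closedBall_zero_iff]
      refine (hB (ν k) (hk.trans_lt ENNReal.coe_lt_top)).trans ?_
      gcongr
      exact ENNReal.toReal_le_coe_of_le_coe hk
    obtain ⟨a, -, ha⟩ :=
      exists_tendsto_of_eventually_mem_isCompact G (isCompact_closedBall _ _) hmem
    exact ⟨a, ha⟩
  choose L hL using exists_limit
  let Λ : C_c(X, ℝ) →ₗ[ℝ] ℝ :=
    { toFun := L
      map_add' := fun g h => tendsto_nhds_unique (hL (g + h)) <|
        ((hL g).add (hL h)).congr fun k => (integral_add (hint g k) (hint h k)).symm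
      map_smul' := fun c g => tendsto_nhds_unique (hL (c • g)) <|
        ((hL g).const_smul c).congr fun k => (integral_smul c g).symm }
  let Λ' : C_c(X, ℝ) →ₚ[ℝ] ℝ := PositiveLinearMap.mk₀ Λ fun g hg =>
    ge_of_tendsto' (hL g) fun k => integral_nonneg fun x => hg x
  refine ⟨RealRMK.rieszMeasure Λ', inferInstance, fun g => ?_⟩
  rw [RealRMK.integral_rieszMeasure]
  exact hL g

theorem exists_forall_measure_le_ofReal_integral_le {K V : Set X} (hK : IsCompact K)
    (hV : IsOpen V) (hKV : K ⊆ V) :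
    ∃ g : C_c(X, ℝ), ∀ (ν : Measure X) [IsFiniteMeasureOnCompacts ν],
      ν K ≤ ENNReal.ofReal (∫ x, g x ∂ν) ∧ ENNReal.ofReal (∫ x, g x ∂ν) ≤ ν V := by
  obtain ⟨f, hf1, hf0, hfc, hf⟩ := exists_continuous_one_zero_of_isCompact hK hV.isClosed_compl
    (disjoint_compl_right_iff_subset.2 hKV)
  refine ⟨⟨f, hfc⟩, fun ν _ => ?_⟩
  have hlint : ENNReal.ofReal (∫ x, f x ∂ν) = ∫⁻ x, ENNReal.ofReal (f x) ∂ν :=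
    ofReal_integral_eq_lintegral_ofReal (f.continuous.integrable_of_hasCompactSupport hfc)
      (Eventually.of_forall fun x => (hf x).1)
  refine ⟨?_, ?_⟩ <;> simp only [CompactlySupportedContinuousMap.coe_mk, hlint]
  · rw [← lintegral_indicator_one hK.measurableSet]
    refine lintegral_mono fun x => ?_
    by_cases hx : x ∈ K
    · simp [hx, hf1 hx]
    · simp [hx]
  · rw [← lintegral_indicator_one hV.measurableSet]
    refine lintegral_mono fun x => ?_
    by_cases hx : x ∈ V
    · simpa [hx] using (hf x).2
    · simp [hx, hf0 hx]

theorem TendstoVague.eventually_measure_le {l : Filter ι} {ν : ι → Measure X} {μ : Measure X}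
    [∀ k, IsFiniteMeasureOnCompacts (ν k)] [IsFiniteMeasureOnCompacts μ] (h : TendstoVague ν l μ)
    {K V : Set X} (hK : IsCompact K) (hV : IsOpen V) (hKV : K ⊆ V) {η : ℝ} (hη : 0 < η) :
    ∀ᶠ k in l, ν k K ≤ μ V + ENNReal.ofReal η ∧ μ K ≤ ν k V + ENNReal.ofReal η := by
  obtain ⟨g, hg⟩ := exists_forall_measure_le_ofReal_integral_le hK hV hKV
  filter_upwards [(h g).eventually (ball_mem_nhds _ hη)] with k hk
  have ofReal_le : ∀ {a b : ℝ}, dist a b < η →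
      ENNReal.ofReal a ≤ ENNReal.ofReal b + ENNReal.ofReal η := fun {a b} hab =>
    (ENNReal.ofReal_le_ofReal (by linarith [(abs_lt.1 hab).2])).trans ENNReal.ofReal_add_le
  constructor
  · calc ν k K ≤ ENNReal.ofReal (∫ x, g x ∂ν k) := (hg (ν k)).1
      _ ≤ ENNReal.ofReal (∫ x, g x ∂μ) + ENNReal.ofReal η := ofReal_le hk
      _ ≤ μ V + ENNReal.ofReal η := by gcongr; exact (hg μ).2
  · calc μ K ≤ ENNReal.ofReal (∫ x, g x ∂μ) := (hg μ).1
      _ ≤ ENNReal.ofReal (∫ x, g x ∂ν k) + ENNReal.ofReal η := ofReal_le (mem_ball'.1 hk)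
      _ ≤ ν k V + ENNReal.ofReal η := by gcongr; exact (hg (ν k)).2

end Vague

section VagueMetric

open Filter

variable {X : Type*} [MetricSpace X]

theorem exists_finite_isCompact_subset_thickening {s : Set X} (hs : IsCompact s) {η : ℝ}
    (hη : 0 < η) : ∃ 𝒦 : Set (Set X), 𝒦.Finite ∧ (∀ K ∈ 𝒦, IsCompact K) ∧
      ∀ A ⊆ s, ∃ K ∈ 𝒦, A ⊆ K ∧ K ⊆ thickening η A := by
  obtain ⟨t, -, ht, hst⟩ := finite_cover_balls_of_compact hs (half_pos hη)
  refine ⟨(fun u => s ∩ ⋃ y ∈ u, closedBall y (η / 2)) '' 𝒫 t, ht.finite_subsets.image _,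
    forall_mem_image.2 fun u hu => hs.inter_right <|
      (ht.subset hu).isClosed_biUnion fun _ _ => isClosed_closedBall, fun A hA => ?_⟩
  refine ⟨_, mem_image_of_mem _ (sep_subset t fun y => (ball y (η / 2) ∩ A).Nonempty), ?_, ?_⟩
  · intro x hx
    obtain ⟨y, hy, hxy⟩ := mem_iUnion₂.1 (hst (hA hx))
    exact ⟨hA hx, mem_biUnion ⟨hy, x, hxy, hx⟩ (ball_subset_closedBall hxy)⟩
  · rintro x ⟨-, hx⟩
    obtain ⟨y, ⟨-, a, hay, ha⟩, hxy⟩ := mem_iUnion₂.1 hx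
    refine mem_thickening_iff.2 ⟨a, ha, ?_⟩
    linarith [dist_triangle_right x a y, mem_closedBall.1 hxy, mem_ball.1 hay]

theorem TendstoVague.eventually_measure_le_thickening [LocallyCompactSpace X] [MeasurableSpace X]
    [BorelSpace X] {ι : Type*} {l : Filter ι} {ν : ι → Measure X} {μ : Measure X}
    [∀ k, IsFiniteMeasureOnCompacts (ν k)] [IsFiniteMeasureOnCompacts μ] (h : TendstoVague ν l μ)
    {s : Set X} (hs : IsCompact s) {η : ℝ} (hη : 0 < η) :
    ∀ᶠ k in l, ∀ A ⊆ s, ν k A ≤ μ (thickening η A) + ENNReal.ofReal η ∧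
      μ A ≤ ν k (thickening η A) + ENNReal.ofReal η := by
  obtain ⟨𝒦, h𝒦, h𝒦c, hA𝒦⟩ := exists_finite_isCompact_subset_thickening hs (half_pos hη)
  have hev := (eventually_all_finite h𝒦).2 fun K hK => h.eventually_measure_le (h𝒦c K hK)
    isOpen_thickening (self_subset_thickening (half_pos hη) K) hη
  filter_upwards [hev] with k hk A hA
  obtain ⟨K, hK, hAK, hKA⟩ := hA𝒦 A hA
  have hKη : thickening (η / 2) K ⊆ thickening η A := calc
    thickening (η / 2) K ⊆ thickening (η / 2) (thickening (η / 2) A) :=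
      thickening_subset_of_subset _ hKA
    _ ⊆ thickening (η / 2 + η / 2) A := thickening_thickening_subset _ _ A
    _ = thickening η A := by rw [add_halves]
  exact ⟨(measure_mono hAK).trans ((hk K hK).1.trans (by gcongr)),
    (measure_mono hAK).trans ((hk K hK).2.trans (by gcongr))⟩

end VagueMetric

namespace RootedSpace

variable {M : Type v} {T T' : RootedSpace.{u, v} M}

@[gcongr]
theorem rootBall_subset_rootBall {r s : ℝ} (h : r ≤ s) : T.rootBall r ⊆ T.rootBall s :=
  closedBall_subset_closedBall h

theorem map_restrict_apply (T : RootedSpace.{u, v} M) (r : ℝ≥0) {Z : Type u} [MetricSpace Z]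
    [MeasurableSpace Z] [BorelSpace Z] {ψ : T.X → Z} (hψ : Isometry ψ) {B : Set Z}
    (hB : MeasurableSet B) :
    (T.restrict r).μ.map (fun x => ψ x.1) B = T.μ (T.rootBall r ∩ ψ ⁻¹' B) := by
  have hψr : Measurable fun x : (T.restrict r).X => ψ x.1 :=
    (hψ.continuous.comp continuous_subtype_val).measurable
  rw [Measure.map_apply hψr hB]
  refine (comap_subtype_coe_apply (s := T.rootBall r) measurableSet_closedBall T.μ _).trans ?_
  exact congrArg T.μ (Subtype.image_preimage_coe (T.rootBall r) (ψ ⁻¹' B))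

theorem deltaC_le [MetricSpace M] {Z : Type u} [MetricSpace Z] {ψ : T.X → Z} {ψ' : T'.X → Z}
    {C : Set (T.X × T'.X)} (hψ : Isometry ψ) (hψ' : Isometry ψ') (hC : IsCorrespondence C)
    (hρ : (T.ρ, T'.ρ) ∈ C) :
    T.deltaC T' ≤ prohorovDist T.μ T'.μ ψ ψ' +
      ⨆ p ∈ C, (edist (ψ p.1) (ψ' p.2) + edist (T.φ p.1) (T'.φ p.2)) :=
  iInf_le_of_le Z <| iInf_le_of_le inferInstance <| iInf_le_of_le ψ <| iInf_le_of_le ψ' <|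
    iInf_le_of_le C <| iInf_le_of_le hψ <| iInf_le_of_le hψ' <| iInf_le_of_le hC <|
      iInf_le_of_le hρ le_rfl

/-- The part of `T` within distance `R` of its root is `θ`-close to a part of `T'` when both spaces
are embedded in `Z`. This is one half of a symmetric notion. -/
structure CloseInto (T T' : RootedSpace.{u, v} M) {Z : Type u} [MetricSpace Z] (ψ : T.X → Z)
    (ψ' : T'.X → Z) (θ R : ℝ) : Prop where
  isometry : Isometry ψ
  isometry' : Isometry ψ'
  dist_root_le : dist (ψ T.ρ) (ψ' T'.ρ) ≤ θ
  exists_dist_le : ∀ x ∈ T.rootBall R, ∃ y, dist (ψ x) (ψ' y) ≤ θ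
  measure_le : ∀ A ⊆ T.rootBall R,
    T.μ A ≤ T'.μ (ψ' ⁻¹' thickening θ (ψ '' A)) + ENNReal.ofReal θ

namespace CloseInto

variable {Z : Type u} [MetricSpace Z] {ψ : T.X → Z} {ψ' : T'.X → Z} {θ R : ℝ}

theorem mem_rootBall_of_dist_le (h : CloseInto T T' ψ ψ' θ R) {r δ : ℝ} {x : T.X} {y : T'.X}
    (hx : x ∈ T.rootBall r) (hxy : dist (ψ x) (ψ' y) ≤ δ) : y ∈ T'.rootBall (r + θ + δ) := by
  have hxρ : dist (ψ x) (ψ T.ρ) ≤ r := h.isometry.dist_eq x T.ρ ▸ hx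
  have hyρ : dist (ψ' y) (ψ' T'.ρ) ≤ r + θ + δ := by
    linarith [dist_triangle4 (ψ' y) (ψ x) (ψ T.ρ) (ψ' T'.ρ), dist_comm (ψ' y) (ψ x),
      h.dist_root_le]
  rwa [h.isometry'.dist_eq] at hyρ

theorem exists_mem_rootBall (h : CloseInto T T' ψ ψ' θ R) (hT' : HasBetween T'.X) {r : ℝ}
    (hr : 0 ≤ r) (hrR : r ≤ R) {x : T.X} (hx : x ∈ T.rootBall r) :
    ∃ y ∈ T'.rootBall r, dist (ψ x) (ψ' y) ≤ 3 * θ := by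
  have hθ : 0 ≤ θ := dist_nonneg.trans h.dist_root_le
  obtain ⟨y, hxy⟩ := h.exists_dist_le x (rootBall_subset_rootBall hrR hx)
  have hy : dist y T'.ρ ≤ r + θ + θ := h.mem_rootBall_of_dist_le hx hxy
  rcases le_or_gt (dist y T'.ρ) r with hyr | hyr
  · exact ⟨y, hyr, by linarith⟩
  · obtain ⟨z, hyz, hzρ⟩ := hT' y T'.ρ (dist y T'.ρ - r) ⟨by linarith, by linarith⟩
    refine ⟨z, mem_closedBall.2 (by linarith), ?_⟩
    rw [← h.isometry'.dist_eq] at hyz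
    linarith [dist_triangle (ψ x) (ψ' y) (ψ' z)]

theorem measure_inter_preimage_le (h : CloseInto T T' ψ ψ' θ R) {s ε : ℝ} (hs : s ≤ R)
    (hε : θ ≤ ε) (B : Set Z) :
    T.μ (T.rootBall s ∩ ψ ⁻¹' B) ≤
      T'.μ (T'.rootBall (s + 2 * θ) ∩ ψ' ⁻¹' thickening ε B) + ENNReal.ofReal θ := by
  refine (h.measure_le _ fun x hx => rootBall_subset_rootBall hs hx.1).trans ?_
  gcongr
  intro y hy
  obtain ⟨_, ⟨x, ⟨hx, hxB⟩, rfl⟩, hyx⟩ := mem_thickening_iff.1 hy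
  refine ⟨?_, mem_thickening_iff.2 ⟨ψ x, hxB, hyx.trans_le hε⟩⟩
  rw [two_mul, ← add_assoc]
  exact h.mem_rootBall_of_dist_le hx (dist_comm (ψ x) _ ▸ hyx.le)

theorem prohorovDist_restrict_le (h : CloseInto T T' ψ ψ' θ R) (h' : CloseInto T' T ψ' ψ θ R)
    {r : ℝ≥0} (hr : r ≤ R) :
    prohorovDist (T.restrict r).μ (T'.restrict r).μ (fun x => ψ x.1) (fun y => ψ' y.1) ≤
      ENNReal.ofReal θ + T.μ (T.rootBall (r + 2 * θ) \ T.rootBall (r - 2 * θ)) := by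
  have hθ : 0 ≤ θ := dist_nonneg.trans h.dist_root_le
  set a := T.μ (T.rootBall (r + 2 * θ) \ T.rootBall (r - 2 * θ))
  have inter_le {s t : ℝ} (hs : s ≤ r + 2 * θ) (ht : r - 2 * θ ≤ t) (B : Set T.X) :
      T.μ (T.rootBall s ∩ B) ≤ T.μ (T.rootBall t ∩ B) + a :=
    (measure_le_inter_add_sdiff T.μ _ (T.rootBall t)).trans <| add_le_add
      (measure_mono fun x hx => ⟨hx.2, hx.1.2⟩)
      (measure_mono fun x hx => ⟨rootBall_subset_rootBall hs hx.1.1,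
        fun hxr => hx.2 (rootBall_subset_rootBall ht hxr)⟩)
  let _ : MeasurableSpace Z := _root_.borel Z
  have : BorelSpace Z := ⟨rfl⟩
  refine levyProkhorovEDist_le_of_forall _ _ _ fun ε B hε hεt hB => ?_
  have hθε : θ ≤ ε.toReal :=
    (ENNReal.ofReal_le_iff_le_toReal hεt.ne).1 (le_self_add.trans hε.le)
  have hBε : MeasurableSet (thickening ε.toReal B) := isOpen_thickening.measurableSet
  simp only [map_restrict_apply _ _ h.isometry hB, map_restrict_apply _ _ h.isometry' hB,
    map_restrict_apply _ _ h.isometry hBε, map_restrict_apply _ _ h.isometry' hBε]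
  constructor
  · calc T.μ (T.rootBall r ∩ ψ ⁻¹' B)
        ≤ T.μ (T.rootBall (r - 2 * θ) ∩ ψ ⁻¹' B) + a := inter_le (by linarith) le_rfl _
      _ ≤ T'.μ (T'.rootBall (r - 2 * θ + 2 * θ) ∩ ψ' ⁻¹' thickening ε.toReal B) +
            ENNReal.ofReal θ + a := by
          gcongr
          exact h.measure_inter_preimage_le (by linarith) hθε B
      _ ≤ T'.μ (T'.rootBall r ∩ ψ' ⁻¹' thickening ε.toReal B) + ε := by
          rw [sub_add_cancel, add_assoc]
          gcongr
  · calc T'.μ (T'.rootBall r ∩ ψ' ⁻¹' B)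
        ≤ T.μ (T.rootBall (r + 2 * θ) ∩ ψ ⁻¹' thickening ε.toReal B) + ENNReal.ofReal θ :=
          h'.measure_inter_preimage_le hr hθε B
      _ ≤ T.μ (T.rootBall r ∩ ψ ⁻¹' thickening ε.toReal B) + a + ENNReal.ofReal θ := by
          gcongr
          exact inter_le le_rfl (by linarith) _
      _ ≤ T.μ (T.rootBall r ∩ ψ ⁻¹' thickening ε.toReal B) + ε := by
          rw [add_assoc, add_comm a]
          gcongr

end CloseInto

variable [MetricSpace M]

/-- `T` and `T'` can be embedded in a metric space in such a way that, in the closed balls of radius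
`R` around their roots, they are `η`-close as measured, rooted, spatial metric spaces. The embedded
spaces are compared at a scale `θ ≤ η` at which the maps into `M` vary by at most `η`. -/
def Close (T T' : RootedSpace.{u, v} M) (η R : ℝ) : Prop :=
  ∃ θ ≤ η, ∃ (Z : Type u) (_ : MetricSpace Z) (ψ : T.X → Z) (ψ' : T'.X → Z),
    CloseInto T T' ψ ψ' θ R ∧ CloseInto T' T ψ' ψ θ R ∧
    ∀ x ∈ T.rootBall R, ∀ y ∈ T'.rootBall R, dist (ψ x) (ψ' y) ≤ 3 * θ →
      dist (T.φ x) (T'.φ y) ≤ η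

theorem Close.deltaC_restrict_le {η R : ℝ} (h : Close T T' η R) (hT : HasBetween T.X)
    (hT' : HasBetween T'.X) {r : ℝ≥0} (hr : r ≤ R) :
    (T.restrict r).deltaC (T'.restrict r) ≤
      ENNReal.ofReal (5 * η) + T.μ (T.rootBall (r + 2 * η) \ T.rootBall (r - 2 * η)) := by
  obtain ⟨θ, hθη, Z, _, ψ, ψ', h, h', hφ⟩ := h
  have hθ : 0 ≤ θ := dist_nonneg.trans h.dist_root_le
  let C : Set ((T.restrict r).X × (T'.restrict r).X) := {p | dist (ψ p.1.1) (ψ' p.2.1) ≤ 3 * θ}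
  have hC : IsCorrespondence C := by
    refine ⟨fun x => ?_, fun y => ?_⟩
    · obtain ⟨y, hy, hxy⟩ := h.exists_mem_rootBall hT' r.2 hr x.2
      exact ⟨⟨y, hy⟩, hxy⟩
    · obtain ⟨x, hx, hxy⟩ := h'.exists_mem_rootBall hT r.2 hr y.2
      exact ⟨⟨x, hx⟩, (dist_comm _ _).trans_le hxy⟩
  have hρC : ((T.restrict r).ρ, (T'.restrict r).ρ) ∈ C :=
    show dist (ψ T.ρ) (ψ' T'.ρ) ≤ 3 * θ by linarith [h.dist_root_le]
  have hsup : ⨆ p ∈ C, (edist (ψ p.1.1) (ψ' p.2.1) +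
      edist ((T.restrict r).φ p.1) ((T'.restrict r).φ p.2)) ≤ ENNReal.ofReal (3 * θ + η) := by
    refine iSup₂_le fun p (hp : dist (ψ p.1.1) (ψ' p.2.1) ≤ 3 * θ) => ?_
    have hφp : dist ((T.restrict r).φ p.1) ((T'.restrict r).φ p.2) ≤ η :=
      hφ p.1.1 (rootBall_subset_rootBall hr p.1.2) p.2.1
        (rootBall_subset_rootBall hr p.2.2) hp
    rw [edist_dist, edist_dist, ← ENNReal.ofReal_add dist_nonneg dist_nonneg]
    exact ENNReal.ofReal_le_ofReal (add_le_add hp hφp)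
  calc (T.restrict r).deltaC (T'.restrict r)
      ≤ (ENNReal.ofReal θ + T.μ (T.rootBall (r + 2 * θ) \ T.rootBall (r - 2 * θ))) +
          ENNReal.ofReal (3 * θ + η) :=
        (deltaC_le (h.isometry.comp isometry_subtype_coe) (h.isometry'.comp isometry_subtype_coe)
          hC hρC).trans (add_le_add (h.prohorovDist_restrict_le h' hr) hsup)
    _ = ENNReal.ofReal (4 * θ + η) + T.μ (T.rootBall (r + 2 * θ) \ T.rootBall (r - 2 * θ)) := by
        rw [add_right_comm, ← ENNReal.ofReal_add hθ (by linarith)]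
        ring_nf
    _ ≤ ENNReal.ofReal (5 * η) + T.μ (T.rootBall (r + 2 * η) \ T.rootBall (r - 2 * η)) := by
        gcongr
        linarith

end RootedSpace

section CloseBound

open Filter Topology RootedSpace

theorem ae_tendsto_sub_of_monotone {ι : Type*} {l : Filter ι} {g : ℝ → ℝ≥0∞} (hg : Monotone g)
    (hg_top : ∀ r, g r ≠ ∞) {c : ι → ℝ} (hc : Tendsto c l (𝓝 0)) :
    ∀ᵐ r : ℝ, Tendsto (fun k => g (r + c k) - g (r - c k)) l (𝓝 0) := by
  filter_upwards [hg.countable_not_continuousAt.ae_notMem volume] with r hr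
  have hr : ContinuousAt g r := not_not.1 hr
  have hadd : Tendsto (fun k => g (r + c k)) l (𝓝 (g r)) :=
    hr.tendsto.comp (by simpa using hc.const_add r)
  have hsub : Tendsto (fun k => g (r - c k)) l (𝓝 (g r)) :=
    hr.tendsto.comp (by simpa using hc.const_sub r)
  simpa using ENNReal.Tendsto.sub hadd hsub (Or.inl (hg_top r))

namespace SpatialTree

variable {M : Type v} [MetricSpace M]

/-- An upper bound for the distance to `T` of the trees that are `η`-close to it on the balls of
radius `R`. -/
def closeBound (T : SpatialTree.{u, v} M) (η R : ℝ) : ℝ≥0∞ :=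
  ∫⁻ r in Ioi (0 : ℝ), ENNReal.ofReal (Real.exp (-r)) *
    min 1 (ENNReal.ofReal (5 * η) + if r ≤ R then
      T.μ (T.rootBall (r + 2 * η)) - T.μ (T.rootBall (r - 2 * η)) else 1)

theorem measure_rootBall_ne_top (T : SpatialTree.{u, v} M) [ProperSpace T.X] (r : ℝ) :
    T.μ (T.rootBall r) ≠ ∞ :=
  have := T.locallyFinite
  measure_closedBall_lt_top.ne

theorem delta_le_closeBound {T T' : SpatialTree.{u, v} M} [ProperSpace T.X] {η R : ℝ}
    (hη : 0 ≤ η) (h : T.Close T'.toRootedSpace η R) : delta T T' ≤ closeBound T η R := by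
  refine setLIntegral_mono' measurableSet_Ioi fun r (hr : 0 < r) => ?_
  refine mul_le_mul_right ?_ _
  split_ifs with hrR
  · have hr' : (r.toNNReal : ℝ) = r := Real.coe_toNNReal r hr.le
    refine min_le_min_left _ ((h.deltaC_restrict_le T.realTree.hasBetween T'.realTree.hasBetween
      (hr'.trans_le hrR)).trans_eq ?_)
    rw [hr', measure_sdiff (rootBall_subset_rootBall (by linarith))
      measurableSet_closedBall.nullMeasurableSet (T.measure_rootBall_ne_top _)]
  · exact le_min (min_le_left _ _) ((min_le_left _ _).trans le_add_self)

theorem tendsto_closeBound (T : SpatialTree.{u, v} M) [ProperSpace T.X] {c R : ℕ → ℝ}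
    (hc : Tendsto c atTop (𝓝 0)) (hR : Tendsto R atTop atTop) :
    Tendsto (fun k => closeBound T (c k) (R k)) atTop (𝓝 0) := by
  have hmono : Monotone fun r => T.μ (T.rootBall r) :=
    fun r s hrs => measure_mono (rootBall_subset_rootBall hrs)
  rw [← lintegral_zero (μ := volume.restrict (Ioi (0 : ℝ)))]
  refine tendsto_lintegral_of_dominated_convergence (fun r => ENNReal.ofReal (Real.exp (-r)))
    (fun k => ?_) (fun k => .of_forall fun r => mul_le_of_le_one_right' (min_le_left _ _))
    (integrableOn_exp_neg_Ioi 0).lintegral_lt_top.ne ?_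
  · refine Measurable.mul (by fun_prop) (measurable_const.min (Measurable.const_add ?_ _))
    exact Measurable.ite measurableSet_Iic ((hmono.measurable.comp (measurable_id.add_const _)).sub
      (hmono.measurable.comp (measurable_id.sub_const _))) measurable_const
  have h2c : Tendsto (fun k => 2 * c k) atTop (𝓝 0) := by simpa using hc.const_mul 2
  have h5c : Tendsto (fun k => ENNReal.ofReal (5 * c k)) atTop (𝓝 0) := by
    simpa using ENNReal.tendsto_ofReal (hc.const_mul 5)
  filter_upwards [ae_restrict_of_ae
    (ae_tendsto_sub_of_monotone hmono T.measure_rootBall_ne_top h2c)] with r hr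
  have hlim := ENNReal.Tendsto.const_mul
    ((tendsto_const_nhds (x := (1 : ℝ≥0∞))).min (h5c.add hr))
    (Or.inr (ENNReal.ofReal_ne_top (r := Real.exp (-r))))
  simp only [add_zero, min_zero, mul_zero] at hlim
  refine hlim.congr' ?_
  filter_upwards [hR.eventually_ge_atTop r] with k hk
  rw [if_pos hk]

theorem tendsto_delta_of_close {ι : Type*} {l : Filter ι} (T : SpatialTree.{u, v} M)
    [ProperSpace T.X] {S : ι → SpatialTree.{u, v} M}
    (h : ∀ η > 0, ∀ R, ∀ᶠ i in l, T.Close (S i).toRootedSpace η R) :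
    Tendsto (fun i => delta T (S i)) l (𝓝 0) := by
  refine ENNReal.tendsto_nhds_zero.2 fun ε hε => ?_
  obtain ⟨k, hk⟩ := ((T.tendsto_closeBound tendsto_one_div_add_atTop_nhds_zero_nat
    tendsto_natCast_atTop_atTop).eventually_lt_const hε).exists
  have hη : (0 : ℝ) < 1 / ((k : ℝ) + 1) := Nat.one_div_pos_of_nat
  filter_upwards [h _ hη k] with i hi
  exact (delta_le_closeBound hη.le hi).trans hk.le

end SpatialTree

end CloseBound

namespace RootedSpace

section Approx

open Filter Topology

variable {M : Type v} [MetricSpace M] {T T' : RootedSpace.{u, v} M}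

/-- `f` maps the ball of radius `R` in `T` to `T'` with an error of order `ε`. -/
structure IsApprox (T T' : RootedSpace.{u, v} M) (f : T.X → T'.X) (R ε : ℝ) : Prop where
  map_root : f T.ρ = T'.ρ
  dist_φ_le : ∀ x ∈ T.rootBall R, dist (T.φ x) (T'.φ (f x)) ≤ ε
  abs_dist_sub_dist_le : ∀ x ∈ T.rootBall R, ∀ y ∈ T.rootBall R,
    |dist (f x) (f y) - dist x y| ≤ 2 * ε
  measure_le : ∀ s ≤ R, T.μ (T.rootBall s) ≤ T'.μ (T'.rootBall (s + 2 * ε)) + ENNReal.ofReal ε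

namespace IsApprox

variable {f : T.X → T'.X} {R R' ε : ℝ}

theorem mono (h : IsApprox T T' f R' ε) (hR : R ≤ R') : IsApprox T T' f R ε where
  map_root := h.map_root
  dist_φ_le x hx := h.dist_φ_le x (rootBall_subset_rootBall hR hx)
  abs_dist_sub_dist_le x hx y hy := h.abs_dist_sub_dist_le x (rootBall_subset_rootBall hR hx) y
    (rootBall_subset_rootBall hR hy)
  measure_le s hs := h.measure_le s (hs.trans hR)

theorem mem_ball (h : IsApprox T T' f R ε) {x : T.X} {s : ℝ} (hx : x ∈ T.rootBall R)
    (hxs : dist x T.ρ + 2 * ε < s) : f x ∈ ball T'.ρ s := by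
  have hρ : T.ρ ∈ T.rootBall R := mem_closedBall_self (dist_nonneg.trans hx)
  have hfx := h.abs_dist_sub_dist_le x hx T.ρ hρ
  rw [h.map_root] at hfx
  exact Metric.mem_ball.2 (by linarith [(abs_le.1 hfx).2])

theorem injOn_and_isSeparated_image (h : IsApprox T T' f R ε) {δ : ℝ≥0} {C : Set T.X}
    (hCR : C ⊆ T.rootBall R) (hC : ∀ x ∈ C, ∀ y ∈ C, x ≠ y → δ + 2 * ε < dist x y) :
    InjOn f C ∧ IsSeparated δ (f '' C) := by
  have hsep (x : T.X) (hx : x ∈ C) (y : T.X) (hy : y ∈ C) (hxy : x ≠ y) :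
      (δ : ℝ) < dist (f x) (f y) := by
    linarith [hC x hx y hy hxy, (abs_le.1 (h.abs_dist_sub_dist_le x (hCR hx) y (hCR hy))).1]
  refine ⟨fun x hx y hy hxy => ?_, ?_⟩
  · by_contra hne
    exact (dist_eq_zero.2 hxy).not_gt (δ.2.trans_lt (hsep x hx y hy hne))
  · rintro _ ⟨x, hx, rfl⟩ _ ⟨y, hy, rfl⟩ hxy
    rw [edist_nndist, ENNReal.coe_lt_coe]
    exact hsep x hx y hy (ne_of_apply_ne f hxy)

theorem of_restrict {r : ℝ≥0} {k : (T.restrict r).X → (T'.restrict r).X}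
    (h : IsApprox (T.restrict r) (T'.restrict r) k r ε) : ∃ f, IsApprox T T' f r ε := by
  classical
  let f (x : T.X) : T'.X := if hx : x ∈ T.rootBall r then (k ⟨x, hx⟩).1 else T'.ρ
  have f_of_mem (x : T.X) (hx : x ∈ T.rootBall r) : f x = (k ⟨x, hx⟩).1 := dif_pos hx
  refine ⟨f, ?_, fun x hx => ?_, fun x hx y hy => ?_, fun s hs => ?_⟩
  · exact (f_of_mem _ (mem_closedBall_self r.2)).trans (congrArg Subtype.val h.map_root)
  · rw [f_of_mem x hx]
    exact h.dist_φ_le ⟨x, hx⟩ hx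
  · rw [f_of_mem x hx, f_of_mem y hy]
    exact h.abs_dist_sub_dist_le ⟨x, hx⟩ hx ⟨y, hy⟩ hy
  · have hμ (S : RootedSpace.{u, v} M) (t : ℝ) :
        (S.restrict r).μ ((S.restrict r).rootBall t) = S.μ (S.rootBall r ∩ S.rootBall t) := by
      refine (comap_subtype_coe_apply (s := S.rootBall r) measurableSet_closedBall S.μ _).trans ?_
      exact congrArg S.μ (Subtype.image_preimage_coe (S.rootBall r) (S.rootBall t))
    have hle := h.measure_le s hs
    rw [hμ, hμ, inter_eq_right.2 (rootBall_subset_rootBall hs)] at hle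
    exact hle.trans (by gcongr; exact inter_subset_right)

end IsApprox

theorem exists_isApprox_of_deltaC_lt {ε : ℝ} (h : T.deltaC T' < ENNReal.ofReal ε) (R : ℝ) :
    ∃ f, IsApprox T T' f R ε := by
  classical
  have hε : 0 < ε := ENNReal.ofReal_pos.1 (pos_of_gt h)
  simp only [deltaC, iInf_lt_iff] at h
  obtain ⟨Z, _, ψ, ψ', D, hψ, hψ', hD, hρ, hlt⟩ := h
  have hpair (p : T.X × T'.X) (hp : p ∈ D) :
      dist (ψ p.1) (ψ' p.2) ≤ ε ∧ dist (T.φ p.1) (T'.φ p.2) ≤ ε := by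
    have hle : edist (ψ p.1) (ψ' p.2) + edist (T.φ p.1) (T'.φ p.2) ≤ ENNReal.ofReal ε :=
      (le_biSup (fun p : T.X × T'.X => edist (ψ p.1) (ψ' p.2) + edist (T.φ p.1) (T'.φ p.2))
        hp).trans (le_add_self.trans hlt.le)
    rw [← edist_le_ofReal hε.le, ← edist_le_ofReal hε.le]
    exact ⟨le_self_add.trans hle, le_add_self.trans hle⟩
  obtain ⟨f, hfρ, hf⟩ : ∃ f : T.X → T'.X, f T.ρ = T'.ρ ∧ ∀ x, (x, f x) ∈ D := by
    choose k hk using hD.1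
    refine ⟨Function.update k T.ρ T'.ρ, Function.update_self .., fun x => ?_⟩
    rcases eq_or_ne x T.ρ with rfl | hx
    · simpa using hρ
    · simpa [hx] using hk x
  refine ⟨f, hfρ, fun x _ => (hpair _ (hf x)).2, fun x _ y _ => ?_, fun s _ => ?_⟩
  · rw [← hψ.dist_eq, ← hψ'.dist_eq, abs_sub_comm, two_mul, ← Real.dist_eq]
    exact (dist_dist_dist_le _ _ _ _).trans
      (add_le_add (hpair _ (hf x)).1 (hpair _ (hf y)).1)
  · let _ : MeasurableSpace Z := _root_.borel Z
    have : BorelSpace Z := ⟨rfl⟩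
    have hle := left_measure_le_of_levyProkhorovEDist_lt (le_self_add.trans_lt hlt)
      (B := closedBall (ψ T.ρ) s) measurableSet_closedBall
    rw [Measure.map_apply hψ.continuous.measurable measurableSet_closedBall,
      Measure.map_apply hψ'.continuous.measurable isOpen_thickening.measurableSet,
      hψ.preimage_closedBall, ENNReal.toReal_ofReal hε.le] at hle
    refine hle.trans (add_le_add_left (measure_mono fun y hy => mem_closedBall.2 ?_) _)
    obtain ⟨z, hz, hyz⟩ := mem_thickening_iff.1 hy
    rw [← hψ'.dist_eq]
    linarith [dist_triangle4 (ψ' y) z (ψ T.ρ) (ψ' T'.ρ), mem_closedBall.1 hz, (hpair _ hρ).1]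

theorem eventually_add_two_mul_lt {a c : ℝ} (h : a < c) :
    ∀ᶠ ε in 𝓝[>] (0 : ℝ), a + 2 * ε < c :=
  nhdsWithin_le_nhds <| (Continuous.tendsto' (by fun_prop) 0 a (by simp)).eventually_lt_const h

theorem packingNumber_le_of_isApprox {δ : ℝ≥0} {R : ℝ} {n : ℕ}
    (h : ∀ᶠ ε in 𝓝[>] (0 : ℝ), ∃ T' : RootedSpace.{u, v} M,
      packingNumber δ (ball T'.ρ R) ≤ n ∧ ∃ f, IsApprox T T' f R ε) :
    packingNumber δ (ball T.ρ R) ≤ n := by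
  refine iSup_le fun D => iSup_le fun hDR => iSup_le fun hD => ?_
  by_contra! hlt
  obtain ⟨C, hCD, hCn⟩ := exists_subset_encard_eq (Order.add_one_le_of_lt hlt)
  have hC : C.Finite := finite_of_encard_eq_coe (k := n + 1) (by exact_mod_cast hCn)
  have hball : ∀ᶠ ε in 𝓝[>] (0 : ℝ), ∀ x ∈ C, dist x T.ρ + 2 * ε < R :=
    hC.eventually_all.2 fun x hx => eventually_add_two_mul_lt (hDR (hCD hx))
  have hsep : ∀ᶠ ε in 𝓝[>] (0 : ℝ), ∀ x ∈ C, ∀ y ∈ C, x ≠ y → δ + 2 * ε < dist x y := by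
    refine hC.eventually_all.2 fun x hx => hC.eventually_all.2 fun y hy => ?_
    refine eventually_imp_distrib_left.2 fun hxy => eventually_add_two_mul_lt ?_
    have hδ : (δ : ℝ≥0∞) < edist x y := hD (hCD hx) (hCD hy) hxy
    rwa [edist_nndist, ENNReal.coe_lt_coe] at hδ
  obtain ⟨ε, ⟨hball, hsep⟩, T', hT', f, hf⟩ := ((hball.and hsep).and h).exists
  have hCR : C ⊆ T.rootBall R := fun x hx => ball_subset_closedBall (hDR (hCD hx))
  obtain ⟨hinj, hfC⟩ := hf.injOn_and_isSeparated_image hCR hsep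
  have hfR : f '' C ⊆ ball T'.ρ R :=
    image_subset_iff.2 fun x hx => hf.mem_ball (hCR hx) (hball x hx)
  have hle : (f '' C).encard ≤ n := (hfC.encard_le_packingNumber hfR).trans hT'
  rw [hinj.encard_image, hCn] at hle
  exact (ENat.lt_add_one_iff (ENat.natCast_ne_top n)).2 le_rfl |>.not_ge hle

theorem measure_rootBall_le_of_isApprox {s R : ℝ} (hs : s < R) {C : ℝ≥0∞}
    (h : ∀ᶠ ε in 𝓝[>] (0 : ℝ), ∃ T' : RootedSpace.{u, v} M,
      (∀ t < R, T'.μ (T'.rootBall t) ≤ C) ∧ ∃ f, IsApprox T T' f R ε) :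
    T.μ (T.rootBall s) ≤ C := by
  have hlim : Tendsto (fun ε : ℝ => C + ENNReal.ofReal ε) (𝓝[>] 0) (𝓝 C) :=
    tendsto_nhdsWithin_of_tendsto_nhds <| Continuous.tendsto'
      (continuous_const.add ENNReal.continuous_ofReal) _ _ (by simp)
  refine ge_of_tendsto hlim ?_
  filter_upwards [eventually_add_two_mul_lt hs, h] with ε hε ⟨T', hT', f, hf⟩
  exact (hf.measure_le s hs.le).trans (add_le_add_left (hT' _ hε) _)

theorem dist_φ_le_of_isApprox {R δ η : ℝ}
    (h : ∀ᶠ ε in 𝓝[>] (0 : ℝ), ∃ T' : RootedSpace.{u, v} M,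
      (∀ x ∈ ball T'.ρ R, ∀ y ∈ ball T'.ρ R, dist x y < δ → dist (T'.φ x) (T'.φ y) ≤ η) ∧
        ∃ f, IsApprox T T' f R ε)
    {x y : T.X} (hx : x ∈ ball T.ρ R) (hy : y ∈ ball T.ρ R) (hxy : dist x y < δ) :
    dist (T.φ x) (T.φ y) ≤ η := by
  refine le_of_forall_gt_imp_ge_of_dense fun c hc => ?_
  obtain ⟨ε, ⟨hεx, hεy⟩, ⟨hεxy, hεc⟩, T', hT', f, hf⟩ :=
    (((eventually_add_two_mul_lt hx).and (eventually_add_two_mul_lt hy)).and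
      (((eventually_add_two_mul_lt hxy).and (eventually_add_two_mul_lt hc)).and h)).exists
  have hxR := ball_subset_closedBall hx
  have hyR := ball_subset_closedBall hy
  have hφ := hT' (f x) (hf.mem_ball hxR hεx) (f y) (hf.mem_ball hyR hεy)
    (by linarith [(abs_le.1 (hf.abs_dist_sub_dist_le x hxR y hyR)).2])
  linarith [dist_triangle4 (T.φ x) (T'.φ (f x)) (T'.φ (f y)) (T.φ y), hf.dist_φ_le x hxR,
    hf.dist_φ_le y hyR, dist_comm (T.φ y) (T'.φ (f y))]

theorem dist_φ_root_le_of_isApprox {m₀ : M} {R₀ : ℝ}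
    (h : ∀ᶠ ε in 𝓝[>] (0 : ℝ), ∃ T' : RootedSpace.{u, v} M,
      dist (T'.φ T'.ρ) m₀ ≤ R₀ ∧ ∃ f, IsApprox T T' f 0 ε) :
    dist (T.φ T.ρ) m₀ ≤ R₀ := by
  refine le_of_forall_pos_le_add fun c hc => ?_
  obtain ⟨ε, hε, T', hT', f, hf⟩ :=
    ((eventually_nhdsWithin_of_eventually_nhds (eventually_lt_nhds hc)).and h).exists
  have hρ := hf.dist_φ_le T.ρ (mem_closedBall_self le_rfl)
  rw [hf.map_root] at hρ
  linarith [dist_triangle (T.φ T.ρ) (T'.φ T'.ρ) m₀]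

end Approx

end RootedSpace

section Bounds

open Filter Topology RootedSpace

/-- The constants in the hypotheses of the compactness criterion. -/
structure TreeBounds (M : Type v) where
  /-- bounds for the size of separated sets -/
  N : ℕ → ℕ
  /-- bounds for the masses of balls -/
  C : ℕ → ℝ≥0
  /-- moduli of continuity -/
  δ : ℕ → ℝ
  δ_pos : ∀ m, 0 < δ m
  /-- a base point -/
  m₀ : M
  /-- the radius of a ball that holds the images of the roots -/
  R₀ : ℝ

theorem packingNumber_le_of_isCover {X : Type*} [PseudoEMetricSpace X] {A : Set X} {ε : ℝ≥0}
    {N : ℕ} {s : Finset X} (hs : IsCover (ε / 2) A (s : Set X)) (hsN : s.card ≤ N) :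
    packingNumber ε A ≤ N := by
  rw [← mul_div_cancel₀ ε (two_ne_zero' ℝ≥0)]
  calc packingNumber (2 * (ε / 2)) A
      ≤ externalCoveringNumber (ε / 2) A := packingNumber_two_mul_le_externalCoveringNumber _ _
    _ ≤ (s : Set X).encard := hs.externalCoveringNumber_le_encard
    _ ≤ N := by rw [encard_coe_eq_coe_finsetCard]; exact_mod_cast hsN

variable {M : Type v} [MetricSpace M]

/-- The space `T` obeys the bounds `b`. Inequalities are strict or not in such a way that the
conditions define a closed set. -/
structure RootedSpace.Obeys (T : RootedSpace.{u, v} M) (b : TreeBounds M) : Prop where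
  packingNumber_le : ∀ m : ℕ, packingNumber (1 / (m + 1)) (ball T.ρ (m + 1)) ≤ b.N m
  measure_rootBall_le : ∀ m : ℕ, ∀ s < (m : ℝ) + 1, T.μ (T.rootBall s) ≤ b.C m
  dist_φ_le : ∀ m : ℕ, ∀ x ∈ ball T.ρ (m + 1), ∀ y ∈ ball T.ρ (m + 1), dist x y < b.δ m →
    dist (T.φ x) (T.φ y) ≤ 1 / (m + 1)
  dist_φ_root_le : dist (T.φ T.ρ) b.m₀ ≤ b.R₀

theorem obeys_of_isApprox {T : RootedSpace.{u, v} M} {b : TreeBounds M}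
    (h : ∀ R : ℝ, ∀ᶠ ε in 𝓝[>] (0 : ℝ), ∃ T' : RootedSpace.{u, v} M,
      T'.Obeys b ∧ ∃ f, IsApprox T T' f R ε) : T.Obeys b where
  packingNumber_le m := packingNumber_le_of_isApprox <|
    (h (m + 1)).mono fun _ ⟨T', hT', hf⟩ => ⟨T', hT'.packingNumber_le m, hf⟩
  measure_rootBall_le m _ hs := measure_rootBall_le_of_isApprox hs <|
    (h (m + 1)).mono fun _ ⟨T', hT', hf⟩ => ⟨T', hT'.measure_rootBall_le m, hf⟩
  dist_φ_le m _ hx _ hy := dist_φ_le_of_isApprox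
    ((h (m + 1)).mono fun _ ⟨T', hT', hf⟩ => ⟨T', hT'.dist_φ_le m, hf⟩) hx hy
  dist_φ_root_le := dist_φ_root_le_of_isApprox <|
    (h 0).mono fun _ ⟨T', hT', hf⟩ => ⟨T', hT'.dist_φ_root_le, hf⟩

namespace SpatialTree

theorem exists_pos_forall_delta_lt_exists_isApprox (T : SpatialTree.{u, v} M) {R ε : ℝ}
    (hR : 0 ≤ R) (hε : 0 < ε) (hε1 : ε ≤ 1) :
    ∃ c : ℝ≥0∞, 0 < c ∧ ∀ T', delta T T' < c →
      ∃ f, IsApprox T.toRootedSpace T'.toRootedSpace f R ε := by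
  refine ⟨ENNReal.ofReal (Real.exp (-(R + 1))) * ENNReal.ofReal ε,
    ENNReal.mul_pos (by simp [Real.exp_pos]) (by simpa using hε), fun T' hT' => ?_⟩
  obtain ⟨r, hr, hlt⟩ : ∃ r ∈ Ioc R (R + 1),
      (T.restrict r.toNNReal).deltaC (T'.restrict r.toNNReal) < ENNReal.ofReal ε := by
    by_contra! hcon
    refine hT'.not_ge ?_
    calc ENNReal.ofReal (Real.exp (-(R + 1))) * ENNReal.ofReal ε
        = ∫⁻ _ in Ioc R (R + 1), ENNReal.ofReal (Real.exp (-(R + 1))) * ENNReal.ofReal ε := by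
          simp
      _ ≤ ∫⁻ r in Ioc R (R + 1), ENNReal.ofReal (Real.exp (-r)) *
            min 1 ((T.restrict r.toNNReal).deltaC (T'.restrict r.toNNReal)) := by
          refine setLIntegral_mono' measurableSet_Ioc fun r hr => ?_
          gcongr
          · exact hr.2
          · exact le_min (by simpa using hε1) (hcon r hr)
      _ ≤ delta T T' := lintegral_mono_set fun r hr => hR.trans_lt hr.1
  obtain ⟨k, hk⟩ := exists_isApprox_of_deltaC_lt hlt r.toNNReal
  obtain ⟨f, hf⟩ := hk.of_restrict
  exact ⟨f, hf.mono (hr.1.le.trans (Real.le_coe_toNNReal r))⟩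

theorem isClosed_obeys (b : TreeBounds M) :
    IsClosed {T : SpatialTree.{u, v} M | T.Obeys b} := by
  refine isOpen_compl_iff.1 fun T hT => ?_
  by_contra! hcon
  refine hT (obeys_of_isApprox fun R => ?_)
  filter_upwards [Ioc_mem_nhdsGT (zero_lt_one' ℝ)] with ε hε
  obtain ⟨c, hc, hT⟩ :=
    T.exists_pos_forall_delta_lt_exists_isApprox (le_max_right R 0) hε.1 hε.2
  obtain ⟨T', hTT', hT'⟩ := hcon c hc
  obtain ⟨f, hf⟩ := hT T' hTT'
  exact ⟨T'.toRootedSpace, not_not.1 hT', f, hf.mono (le_max_left R 0)⟩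

theorem Equivalent.isApprox {T T' : SpatialTree.{u, v} M} (h : Equivalent T T') {R ε : ℝ}
    (hε : 0 ≤ ε) : ∃ f, IsApprox T.toRootedSpace T'.toRootedSpace f R ε := by
  obtain ⟨π, hμ, hφ, hρ⟩ := h
  refine ⟨π, hρ, fun x _ => ?_, fun x _ y _ => ?_, fun s _ => ?_⟩
  · rwa [← hφ, dist_self]
  · rw [π.isometry.dist_eq, sub_self, abs_zero]
    positivity
  · rw [← hμ, rootBall, rootBall, ← hρ, Measure.map_apply π.continuous.measurable
      measurableSet_closedBall, π.isometry.preimage_closedBall]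
    exact le_add_right (measure_mono (closedBall_subset_closedBall (by linarith)))

theorem Equivalent.obeys {T T' : SpatialTree.{u, v} M} {b : TreeBounds M} (h : Equivalent T T')
    (hT' : T'.Obeys b) : T.Obeys b :=
  obeys_of_isApprox fun _ => eventually_nhdsWithin_of_forall fun _ hε =>
    ⟨T'.toRootedSpace, hT', h.isApprox (le_of_lt hε)⟩

end SpatialTree

theorem SpatialTree.exists_forall_obeys (A : Set (SpatialTree.{u, v} M)) (hA : A.Nonempty)
    (cover : ∀ r : ℝ, 0 < r → ∀ ε : ℝ≥0, 0 < ε → ∃ N : ℕ, ∀ T ∈ A,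
      ∃ s : Finset T.X, s.card < N ∧ IsCover ε (T.rootBall r) (s : Set T.X))
    (mass : ∀ r : ℝ, 0 < r → (⨆ T ∈ A, T.μ (T.rootBall r)) < ∞)
    (root : Bornology.IsBounded {m : M | ∃ T ∈ A, m = T.φ T.ρ})
    (equi : ∀ r : ℝ, 0 < r → ∀ ε : ℝ≥0, 0 < ε → ∃ δ : ℝ, 0 < δ ∧
      (⨆ T ∈ A, ⨆ (x ∈ T.rootBall r) (y ∈ T.rootBall r) (_ : dist x y ≤ δ),
        edist (T.φ x) (T.φ y)) < ε) :
    ∃ b : TreeBounds M, ∀ T ∈ A, T.Obeys b := by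
  obtain ⟨T₀, -⟩ := hA
  obtain ⟨R₀, hR₀⟩ := root.subset_closedBall (T₀.φ T₀.ρ)
  have hm (m : ℕ) : (0 : ℝ) < m + 1 := by positivity
  choose N hN using fun m : ℕ => cover (m + 1) (hm m) (1 / (m + 1) / 2) (by positivity)
  choose δ hδ hδ' using fun m : ℕ => equi (m + 1) (hm m) (1 / (m + 1)) (by positivity)
  refine ⟨⟨N, fun m => (⨆ T ∈ A, T.μ (T.rootBall (m + 1))).toNNReal, δ, hδ, T₀.φ T₀.ρ, R₀⟩,
    fun T hT => ⟨fun m => ?_, fun m s hs => ?_, fun m x hx y hy hxy => ?_, hR₀ ⟨T, hT, rfl⟩⟩⟩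
  · obtain ⟨s, hsN, hs⟩ := hN m T hT
    exact packingNumber_le_of_isCover (hs.anti ball_subset_closedBall) hsN.le
  · rw [ENNReal.coe_toNNReal (mass _ (hm m)).ne]
    exact (measure_mono (rootBall_subset_rootBall hs.le)).trans
      (le_iSup₂ (f := fun (T : SpatialTree.{u, v} M) (_ : T ∈ A) => T.μ (T.rootBall (m + 1))) T hT)
  · have hφ : edist (T.φ x) (T.φ y) < ((1 / (m + 1) : ℝ≥0) : ℝ≥0∞) :=
      (le_iSup₂_of_le T hT <| le_iSup₂_of_le x (ball_subset_closedBall hx) <|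
        le_iSup₂_of_le y (ball_subset_closedBall hy) <|
        le_iSup (fun _ : dist x y ≤ δ m => edist (T.φ x) (T.φ y)) hxy.le).trans_lt (hδ' m)
    rw [edist_nndist, ENNReal.coe_lt_coe] at hφ
    simpa using (NNReal.coe_lt_coe.2 hφ).le

end Bounds

section Nets

variable {Y : Type*} [MetricSpace Y] {o : Y}

theorem exists_seq_of_packingNumber_le {A : Set Y} {ε : ℝ≥0} {n : ℕ} (ho : o ∈ A)
    (h : packingNumber ε A ≤ n) : ∃ f : ℕ → Y, f 0 = o ∧ (∀ j, f j ∈ A) ∧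
      ∀ y ∈ A, ∃ j ≤ n, dist y (f j) ≤ ε := by
  have hcover : coveringNumber ε A ≤ n := (coveringNumber_le_packingNumber ε A).trans h
  obtain ⟨C, hCA, hCfin, hC, hCcard⟩ :=
    exists_set_encard_eq_coveringNumber (ne_top_of_le_ne_top (ENat.natCast_ne_top n) hcover)
  lift C to Finset Y using hCfin
  rw [← hCcard, encard_coe_eq_coe_finsetCard, Nat.cast_le, ← Finset.length_toList] at hcover
  have getD_mem (j : ℕ) : C.toList.getD j o ∈ A := by
    rcases lt_or_ge j C.toList.length with hj | hj
    · rw [List.getD_eq_getElem _ _ hj]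
      exact hCA (Finset.mem_toList.1 (List.getElem_mem hj))
    · rwa [List.getD_eq_default _ _ hj]
  refine ⟨fun j => (o :: C.toList).getD j o, rfl, fun j => ?_, fun y hy => ?_⟩
  · cases j with
    | zero => exact ho
    | succ j => exact getD_mem j
  · obtain ⟨x, hx, hyx⟩ := hC hy
    obtain ⟨j, hj, rfl⟩ := List.getElem_of_mem (Finset.mem_toList.2 hx)
    refine ⟨j + 1, (Nat.succ_le_of_lt hj).trans hcover, ?_⟩
    simp only [List.getD_cons_succ, List.getD_eq_getElem _ _ hj]
    exact edist_le_coe.1 hyx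

theorem exists_measurable_index [MeasurableSpace Y] [OpensMeasurableSpace Y] {x : ℕ → Y} {n : ℕ}
    {r ε : ℝ} (hx : ∀ y, dist y o < r → ∃ j ≤ n, dist y (x j) ≤ ε) :
    ∃ κ : Y → ℕ, Measurable κ ∧ ∀ y, dist y o < r → κ y ≤ n ∧ dist y (x (κ y)) ≤ ε := by
  classical
  have h (y : Y) : ∃ j, dist y (x j) ≤ ε ∨ r ≤ dist y o := by
    rcases lt_or_ge (dist y o) r with hy | hy
    · obtain ⟨j, -, hj⟩ := hx y hy
      exact ⟨j, Or.inl hj⟩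
    · exact ⟨0, Or.inr hy⟩
  refine ⟨fun y => Nat.find (h y), measurable_find h fun j => ?_, fun y hy => ⟨?_, ?_⟩⟩
  · have hball : IsClosed {y | dist y (x j) ≤ ε} := isClosed_closedBall
    have hcompl : IsClosed {y | r ≤ dist y o} := isClosed_le continuous_const (by fun_prop)
    exact (hball.union hcompl).measurableSet
  · obtain ⟨j, hj, hyj⟩ := hx y hy
    exact (Nat.find_min' (h y) (Or.inl hyj)).trans hj
  · exact (Nat.find_spec (h y)).resolve_right hy.not_ge

/-- Finite nets of the balls of radii `1, 2, …` around `o`, of sizes bounded by `N`. The points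
`pt (m, j)`, `j ≤ N m`, form a `1 / (m + 1)`-net of the ball of radius `m + 1`. -/
structure Nets (Y : Type*) [MetricSpace Y] [MeasurableSpace Y] (o : Y) (N : ℕ → ℕ) where
  /-- the points of the nets -/
  pt : ℕ × ℕ → Y
  /-- the index of a point of the net at scale `m` that is close to a given point -/
  index : ℕ → Y → ℕ
  pt_zero : ∀ m, pt (m, 0) = o
  dist_pt_lt : ∀ p, dist (pt p) o < p.1 + 1
  measurable_index : ∀ m, Measurable (index m)
  index_le : ∀ (m : ℕ) (y : Y), dist y o < m + 1 → index m y ≤ N m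
  dist_index_le : ∀ (m : ℕ) (y : Y), dist y o < m + 1 →
    dist y (pt (m, index m y)) ≤ 1 / ((m : ℝ) + 1)

theorem nonempty_nets [MeasurableSpace Y] [OpensMeasurableSpace Y] {N : ℕ → ℕ}
    (h : ∀ m : ℕ, packingNumber (1 / (m + 1)) (ball o (m + 1)) ≤ N m) : Nonempty (Nets Y o N) := by
  choose f hf0 hfo hf using fun m : ℕ =>
    exists_seq_of_packingNumber_le (mem_ball_self (by positivity : (0 : ℝ) < m + 1)) (h m)
  choose κ hκ hκf using fun m => exists_measurable_index (hf m)
  exact ⟨fun p => f p.1 p.2, κ, hf0, fun p => hfo p.1 p.2, hκ, fun m y hy => (hκf m y hy).1,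
    fun m y hy => by simpa using (hκf m y hy).2⟩

end Nets

section NetLimit

open Filter Topology

variable {I : Type*} {F : Ultrafilter I}

theorem exists_ultralimit_space (F : Ultrafilter I) {J : Type u} {Y : I → Type*}
    [∀ i, MetricSpace (Y i)] (x : ∀ i, J → Y i)
    (hx : ∀ p q, ∃ B, ∀ i, dist (x i p) (x i q) ≤ B) :
    ∃ (X : Type u) (_ : MetricSpace X) (_ : CompleteSpace X) (z : J → X), DenseRange z ∧
      ∀ p q, Tendsto (fun i => dist (x i p) (x i q)) F (𝓝 (dist (z p) (z q))) := by
  have exists_limit : ∀ p q, ∃ a, Tendsto (fun i => dist (x i p) (x i q)) F (𝓝 a) := by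
    intro p q
    obtain ⟨B, hB⟩ := hx p q
    obtain ⟨a, -, ha⟩ := exists_tendsto_of_eventually_mem_isCompact F
      (isCompact_Icc (a := (0 : ℝ)) (b := B)) (Eventually.of_forall fun i => ⟨dist_nonneg, hB i⟩)
    exact ⟨a, ha⟩
  choose d hd using exists_limit
  let _ : PseudoMetricSpace J :=
    { dist := d
      dist_self := fun p => tendsto_nhds_unique (hd p p) (by simp)
      dist_comm := fun p q => tendsto_nhds_unique (hd p q) (by simpa only [dist_comm] using hd q p)
      dist_triangle := fun p q r => le_of_tendsto_of_tendsto' (hd p r) ((hd p q).add (hd q r))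
        fun i => dist_triangle _ _ _ }
  refine ⟨UniformSpace.Completion J, inferInstance, inferInstance, (↑),
    UniformSpace.Completion.denseRange_coe, fun p q => ?_⟩
  rw [UniformSpace.Completion.dist_eq]
  exact hd p q

theorem exists_continuous_extension {J X M : Type*} [MetricSpace X] [MetricSpace M]
    [CompleteSpace M] {z : J → X} (hz : DenseRange z) {φ : J → M}
    (h : ∀ x : X, ∀ ε > 0, ∃ δ > 0, ∀ p q, dist (z p) x < δ → dist (z q) x < δ →
      dist (φ p) (φ q) ≤ ε) :
    ∃ Φ : X → M, Continuous Φ ∧ ∀ p, Φ (z p) = φ p := by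
  let _ : TopologicalSpace J := TopologicalSpace.induced z inferInstance
  have hi : IsDenseInducing z := ⟨⟨rfl⟩, hz⟩
  have exists_limit : ∀ x, ∃ c, Tendsto φ (comap z (𝓝 x)) (𝓝 c) := by
    intro x
    have := hi.comap_nhds_neBot x
    refine cauchy_map_iff_exists_tendsto.1 (Metric.cauchy_iff.2 ⟨inferInstance, fun ε hε => ?_⟩)
    obtain ⟨δ, hδ, hφ⟩ := h x (ε / 2) (half_pos hε)
    refine ⟨φ '' (z ⁻¹' ball x δ), image_mem_map (preimage_mem_comap (ball_mem_nhds _ hδ)), ?_⟩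
    rintro _ ⟨p, hp, rfl⟩ _ ⟨q, hq, rfl⟩
    exact (hφ p q hp hq).trans_lt (half_lt_self hε)
  exact ⟨hi.extend φ, hi.continuous_extend exists_limit, hi.extend_eq' exists_limit⟩

theorem exists_nat_gt_and_one_div_lt (R : ℝ) {ε : ℝ} (hε : 0 < ε) :
    ∃ m : ℕ, R < m ∧ 1 / ((m : ℝ) + 1) < ε :=
  ((tendsto_natCast_atTop_atTop.eventually_gt_atTop R).and
    (tendsto_one_div_add_atTop_nhds_zero_nat.eventually_lt_const hε)).exists

theorem HasBetween.exists_dist_le {X : Type u} [MetricSpace X] (h : HasBetween X) (a b : X)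
    {t : ℝ} (ht : 0 ≤ t) : ∃ y, dist a y ≤ t ∧ dist y b ≤ max (dist a b - t) 0 := by
  obtain ⟨y, hay, hyb⟩ := h a b (min t (dist a b)) ⟨le_min ht dist_nonneg, min_le_right _ _⟩
  refine ⟨y, hay.trans_le (min_le_left _ _), hyb.trans_le ?_⟩
  rcases min_choice t (dist a b) with hmin | hmin <;> simp [hmin]

theorem hasBetween_of_forall_exists_le {X : Type u} [MetricSpace X] [ProperSpace X]
    (h : ∀ a b : X, ∀ t ∈ Icc 0 (dist a b), ∀ ε > 0,
      ∃ y, dist a y ≤ t + ε ∧ dist y b ≤ dist a b - t + ε) : HasBetween X := by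
  intro a b t ht
  obtain ⟨y, -, hmin⟩ := (isCompact_closedBall a (t + 1)).exists_isMinOn
    ⟨a, mem_closedBall_self (by linarith [ht.1])⟩
    (f := fun y => max (dist a y - t) (dist y b - (dist a b - t))) (by fun_prop)
  have hle : max (dist a y - t) (dist y b - (dist a b - t)) ≤ 0 := by
    refine le_of_forall_pos_le_add fun ε hε => ?_
    obtain ⟨w, haw, hwb⟩ := h a b t ht (min ε 1) (by positivity)
    have hwa : w ∈ closedBall a (t + 1) := by
      rw [mem_closedBall']
      linarith [min_le_right ε 1]
    refine (hmin hwa).trans (max_le ?_ ?_) <;> linarith [min_le_left ε 1]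
  obtain ⟨hay, hyb⟩ := max_le_iff.1 hle
  exact ⟨y, by linarith [dist_triangle a y b], by linarith [dist_triangle a y b]⟩

variable {Y : I → Type v} [∀ i, MetricSpace (Y i)] [∀ i, MeasurableSpace (Y i)] {o : ∀ i, Y i}
  {N : ℕ → ℕ} {x : ∀ i, Nets (Y i) (o i) N} {X : Type u} [MetricSpace X] {z : ℕ × ℕ → X}

/-- The points `z p` are dense in `X`, and they are the limits of the points of the nets `x i`, as
far as mutual distances are concerned. Then `X` is a limit of the spaces `Y i`. -/
structure IsNetLimit (F : Ultrafilter I) (x : ∀ i, Nets (Y i) (o i) N) (z : ℕ × ℕ → X) :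
    Prop where
  denseRange : DenseRange z
  tendsto_dist : ∀ p q, Tendsto (fun i => dist ((x i).pt p) ((x i).pt q)) F (𝓝 (dist (z p) (z q)))

theorem exists_isNetLimit (F : Ultrafilter I) (x : ∀ i, Nets (Y i) (o i) N) :
    ∃ (X : Type u) (_ : MetricSpace X) (_ : CompleteSpace X) (z : ℕ × ℕ → X),
      IsNetLimit F x z := by
  have dist_pt_le (p q : ℕ × ℕ) (i : I) :
      dist ((x i).pt p) ((x i).pt q) ≤ (p.1 + 1) + (q.1 + 1) :=
    (dist_triangle_right _ _ (o i)).trans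
      (add_le_add ((x i).dist_pt_lt p).le ((x i).dist_pt_lt q).le)
  obtain ⟨X, hX, hX', z, hz, hlim⟩ := exists_ultralimit_space F
    (fun i (p : ULift.{u} (ℕ × ℕ)) => (x i).pt p.down) fun p q => ⟨_, dist_pt_le p.down q.down⟩
  refine ⟨X, hX, hX', fun p => z ⟨p⟩, ?_, fun p q => hlim ⟨p⟩ ⟨q⟩⟩
  exact hz.comp (ULift.up_surjective.denseRange) continuous_of_discreteTopology

theorem Nets.exists_eventually_dist_le {m : ℕ} {y : ∀ i, Y i}
    (hy : ∀ᶠ i in F, dist (y i) (o i) < m + 1) :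
    ∃ j ≤ N m, ∀ᶠ i in F, dist (y i) ((x i).pt (m, j)) ≤ 1 / ((m : ℝ) + 1) :=
  (Ultrafilter.eventually_exists_mem_iff (finite_Iic (N m))).1 <|
    hy.mono fun i hi => ⟨(x i).index m (y i), (x i).index_le m _ hi, (x i).dist_index_le m _ hi⟩

namespace IsNetLimit

variable (h : IsNetLimit F x z)
include h

theorem apply_zero (m : ℕ) : z (m, 0) = z (0, 0) := by
  refine dist_eq_zero.1 (tendsto_nhds_unique (h.tendsto_dist _ _) ?_)
  simp [Nets.pt_zero]

theorem tendsto_dist_root (p : ℕ × ℕ) :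
    Tendsto (fun i => dist ((x i).pt p) (o i)) F (𝓝 (dist (z p) (z (0, 0)))) := by
  simpa only [Nets.pt_zero] using h.tendsto_dist p (0, 0)

theorem exists_dist_le {m : ℕ} {y : X} (hy : dist y (z (0, 0)) < m + 1) :
    ∃ j ≤ N m, dist y (z (m, j)) ≤ 2 * (1 / ((m : ℝ) + 1)) := by
  obtain ⟨p, hp⟩ := h.denseRange.exists_dist_lt y
    (lt_min (Nat.one_div_pos_of_nat (α := ℝ) (n := m)) (sub_pos.2 hy))
  obtain ⟨hpm, hpy⟩ := lt_min_iff.1 hp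
  have hroot : dist (z p) (z (0, 0)) < m + 1 := by
    linarith [dist_triangle_left (z p) (z (0, 0)) y]
  obtain ⟨j, hj, hpj⟩ :=
    Nets.exists_eventually_dist_le (x := x) ((h.tendsto_dist_root p).eventually_lt_const hroot)
  refine ⟨j, hj, ?_⟩
  linarith [dist_triangle y (z p) (z (m, j)), le_of_tendsto (h.tendsto_dist p (m, j)) hpj]

theorem properSpace [CompleteSpace X] : ProperSpace X := by
  refine .of_isCompact_closedBall_of_le 0 fun y R _ => ?_
  refine TotallyBounded.isCompact_of_isClosed (Metric.totallyBounded_iff.2 fun ε hε => ?_)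
    isClosed_closedBall
  obtain ⟨m, hm, hmε⟩ := exists_nat_gt_and_one_div_lt (R + dist y (z (0, 0))) (half_pos hε)
  refine ⟨(fun j => z (m, j)) '' Iic (N m), (finite_Iic _).image _, fun w hw => ?_⟩
  obtain ⟨j, hj, hwj⟩ := h.exists_dist_le (m := m) (y := w)
    (by linarith [dist_triangle w y (z (0, 0)), mem_closedBall.1 hw])
  exact mem_biUnion (mem_image_of_mem _ hj) (mem_ball.2 (by linarith))

theorem fourPoint (hY : ∀ i, FourPoint (Y i)) : FourPoint X := by
  intro a b c d
  refine h.denseRange.induction_on a (isClosed_le (by fun_prop) (by fun_prop)) fun p => ?_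
  refine h.denseRange.induction_on b (isClosed_le (by fun_prop) (by fun_prop)) fun q => ?_
  refine h.denseRange.induction_on c (isClosed_le (by fun_prop) (by fun_prop)) fun r => ?_
  refine h.denseRange.induction_on d (isClosed_le (by fun_prop) (by fun_prop)) fun s => ?_
  exact le_of_tendsto_of_tendsto' ((h.tendsto_dist p q).add (h.tendsto_dist r s))
    (((h.tendsto_dist p r).add (h.tendsto_dist q s)).max
      ((h.tendsto_dist p s).add (h.tendsto_dist q r))) fun i => hY i _ _ _ _

theorem exists_almost_between (hY : ∀ i, HasBetween (Y i)) (p q : ℕ × ℕ) {t ε : ℝ} (ht : 0 ≤ t)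
    (hε : 0 < ε) :
    ∃ y, dist (z p) y ≤ t + ε ∧ dist y (z q) ≤ max (dist (z p) (z q) - t) 0 + ε := by
  obtain ⟨m, hm, hmε⟩ := exists_nat_gt_and_one_div_lt (dist (z p) (z (0, 0)) + t) hε
  choose y hpy hyq using fun i => (hY i).exists_dist_le ((x i).pt p) ((x i).pt q) ht
  have hroot : ∀ᶠ i in F, dist (y i) (o i) < m + 1 := by
    filter_upwards [(h.tendsto_dist_root p).eventually_lt_const (lt_sub_iff_add_lt.2 hm)] with i hi
    linarith [dist_triangle_left (y i) (o i) ((x i).pt p), hpy i]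
  obtain ⟨j, -, hyj⟩ := Nets.exists_eventually_dist_le (x := x) hroot
  refine ⟨z (m, j), le_of_tendsto (h.tendsto_dist p (m, j)) ?_, le_of_tendsto_of_tendsto
    (h.tendsto_dist (m, j) q)
    ((((h.tendsto_dist p q).sub_const t).max tendsto_const_nhds).add_const ε) ?_⟩
  · filter_upwards [hyj] with i hi
    linarith [dist_triangle ((x i).pt p) (y i) ((x i).pt (m, j)), hpy i]
  · filter_upwards [hyj] with i hi
    linarith [dist_triangle_left ((x i).pt (m, j)) ((x i).pt q) (y i), hyq i]

theorem hasBetween [CompleteSpace X] (hY : ∀ i, HasBetween (Y i)) : HasBetween X := by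
  have := h.properSpace
  refine hasBetween_of_forall_exists_le fun a b t ht ε hε => ?_
  obtain ⟨p, hp⟩ := h.denseRange.exists_dist_lt a (by positivity : 0 < ε / 4)
  obtain ⟨q, hq⟩ := h.denseRange.exists_dist_lt b (by positivity : 0 < ε / 4)
  obtain ⟨y, hpy, hyq⟩ := h.exists_almost_between hY p q ht.1 (by positivity : 0 < ε / 4)
  have hmax : max (dist (z p) (z q) - t) 0 ≤ dist a b - t + ε / 2 := by
    refine max_le ?_ (by linarith [ht.2])
    linarith [dist_triangle4 (z p) a b (z q), dist_comm a (z p)]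
  exact ⟨y, by linarith [dist_triangle a (z p) y],
    by linarith [dist_triangle y (z q) b, dist_comm b (z q)]⟩

theorem exists_limit_map {M : Type*} [MetricSpace M] [CompleteSpace M] {φ : ∀ i, Y i → M}
    (hφK : ∀ p, ∃ K, IsCompact K ∧ ∀ i, φ i ((x i).pt p) ∈ K)
    (hφ : ∀ m : ℕ, ∃ δ > 0, ∀ i, ∀ y ∈ ball (o i) (m + 1), ∀ w ∈ ball (o i) (m + 1),
      dist y w < δ → dist (φ i y) (φ i w) ≤ 1 / (m + 1)) :
    ∃ Φ : X → M, Continuous Φ ∧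
      ∀ p, Tendsto (fun i => φ i ((x i).pt p)) F (𝓝 (Φ (z p))) := by
  have exists_limit (p : ℕ × ℕ) : ∃ c, Tendsto (fun i => φ i ((x i).pt p)) F (𝓝 c) := by
    obtain ⟨K, hK, hpK⟩ := hφK p
    obtain ⟨c, -, hc⟩ :=
      exists_tendsto_of_eventually_mem_isCompact F hK (Eventually.of_forall hpK)
    exact ⟨c, hc⟩
  choose ψ hψ using exists_limit
  obtain ⟨Φ, hΦ, hΦψ⟩ := exists_continuous_extension h.denseRange (φ := ψ) fun y ε hε => by
    obtain ⟨m, hm, hmε⟩ := exists_nat_gt_and_one_div_lt (dist y (z (0, 0))) hε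
    obtain ⟨δ, hδ, hφδ⟩ := hφ m
    refine ⟨min (δ / 2) 1, by positivity, fun p q hp hq => ?_⟩
    obtain ⟨hpδ, hp1⟩ := lt_min_iff.1 hp
    obtain ⟨hqδ, hq1⟩ := lt_min_iff.1 hq
    have hp_root : dist (z p) (z (0, 0)) < m + 1 := by
      linarith [dist_triangle (z p) y (z (0, 0))]
    have hq_root : dist (z q) (z (0, 0)) < m + 1 := by
      linarith [dist_triangle (z q) y (z (0, 0))]
    have hpq : dist (z p) (z q) < δ := by linarith [dist_triangle_right (z p) (z q) y]
    refine (le_of_tendsto ((hψ p).dist (hψ q)) ?_).trans hmε.le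
    filter_upwards [(h.tendsto_dist_root p).eventually_lt_const hp_root,
      (h.tendsto_dist_root q).eventually_lt_const hq_root,
      (h.tendsto_dist p q).eventually_lt_const hpq] with i hip hiq hipq
    exact hφδ i _ hip _ hiq hipq
  exact ⟨Φ, hΦ, fun p => by rw [hΦψ]; exact hψ p⟩

end IsNetLimit

end NetLimit

section Convergence

open Filter Topology

theorem exists_glue {X Y P : Type u} [MetricSpace X] [MetricSpace Y] [Nonempty P] (a : P → X)
    (c : P → Y) {ε : ℝ} (hε : 0 < ε) (h : ∀ p q, |dist (a p) (a q) - dist (c p) (c q)| ≤ 2 * ε) :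
    ∃ (Z : Type u) (_ : MetricSpace Z) (ψ : X → Z) (ψ' : Y → Z), Isometry ψ ∧ Isometry ψ' ∧
      ∀ p, dist (ψ (a p)) (ψ' (c p)) = ε := by
  let _ : MetricSpace (X ⊕ Y) := glueMetricApprox a c ε hε h
  exact ⟨X ⊕ Y, inferInstance, Sum.inl, Sum.inr, Isometry.of_dist_eq fun _ _ => rfl,
    Isometry.of_dist_eq fun _ _ => rfl, fun p => glueDist_glued_points a c ε p⟩

/-- Isometric embeddings of `X` and `Y` into a common space that nearly identify each point
`z (m, j)` of `X` with the point `x.pt (m, j)` of the net of `Y` at scale `m`. The points `z (m, j)`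
form a net of the ball of radius `m + 1` around `z (m, 0) = o'`. -/
structure IsGluing {X Y Z : Type*} [MetricSpace X] [MetricSpace Y] [MetricSpace Z]
    [MeasurableSpace Y] {o : Y} {N : ℕ → ℕ} (z : ℕ × ℕ → X) (x : Nets Y o N) (m : ℕ) (o' : X)
    (ψ : X → Z) (ψ' : Y → Z) : Prop where
  isometry : Isometry ψ
  isometry' : Isometry ψ'
  apply_zero : z (m, 0) = o'
  exists_dist_le : ∀ a, dist a o' < m + 1 → ∃ j ≤ N m, dist a (z (m, j)) ≤ 2 * (1 / ((m : ℝ) + 1))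
  dist_le : ∀ j ≤ N m, dist (ψ (z (m, j))) (ψ' (x.pt (m, j))) ≤ 1 / ((m : ℝ) + 1)

theorem IsNetLimit.eventually_exists_isGluing {I : Type*} {F : Ultrafilter I} {Y : I → Type u}
    [∀ i, MetricSpace (Y i)] [∀ i, MeasurableSpace (Y i)] {o : ∀ i, Y i} {N : ℕ → ℕ}
    {x : ∀ i, Nets (Y i) (o i) N} {X : Type u} [MetricSpace X] {z : ℕ × ℕ → X}
    (h : IsNetLimit F x z) (m : ℕ) :
    ∀ᶠ i in F, ∃ (Z : Type u) (_ : MetricSpace Z) (ψ : X → Z) (ψ' : Y i → Z),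
      IsGluing z (x i) m (z (0, 0)) ψ ψ' := by
  have hm : 0 < 1 / ((m : ℝ) + 1) := by positivity
  have hclose : ∀ᶠ i in F, ∀ j ∈ Iic (N m), ∀ j' ∈ Iic (N m),
      |dist (z (m, j)) (z (m, j')) - dist ((x i).pt (m, j)) ((x i).pt (m, j'))| <
        2 * (1 / ((m : ℝ) + 1)) := by
    refine (eventually_all_finite (finite_Iic _)).2 fun j _ =>
      (eventually_all_finite (finite_Iic _)).2 fun j' _ => ?_
    have hlim := (tendsto_const_nhds.sub (h.tendsto_dist (m, j) (m, j'))).abs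
      (a := dist (z (m, j)) (z (m, j')) - dist (z (m, j)) (z (m, j')))
    exact hlim.eventually_lt_const (by rw [sub_self, abs_zero]; positivity)
  filter_upwards [hclose] with i hi
  have : Nonempty (ULift.{u} (Iic (N m))) := ⟨⟨⟨0, Nat.zero_le _⟩⟩⟩
  obtain ⟨Z, hZ, ψ, ψ', hψ, hψ', hdist⟩ := exists_glue
    (fun j : ULift.{u} (Iic (N m)) => z (m, j.down)) (fun j => (x i).pt (m, j.down)) hm
    fun p q => (hi _ p.down.2 _ q.down.2).le
  exact ⟨Z, hZ, ψ, ψ', hψ, hψ', h.apply_zero m, fun _ => h.exists_dist_le,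
    fun j hj => (hdist ⟨⟨j, hj⟩⟩).le⟩

section ApproxMeasure

variable {X Y : Type*} [MetricSpace Y] [MeasurableSpace Y] {o : Y} {N : ℕ → ℕ}

/-- The map that takes `y` to the point of `X` corresponding to a nearby point of the net of `Y` at
scale `m`. -/
def Nets.transport (x : Nets Y o N) (z : ℕ × ℕ → X) (m : ℕ) (y : Y) : X := z (m, x.index m y)

variable [MeasurableSpace X]

theorem Nets.measurable_transport (x : Nets Y o N) (z : ℕ × ℕ → X) (m : ℕ) :
    Measurable (x.transport z m) :=
  (measurable_from_nat (f := fun j => z (m, j))).comp (x.measurable_index m)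

/-- The restriction of the measure `ν` to the ball of radius `m + 1`, transported to `X`. -/
def Nets.approxMeasure (x : Nets Y o N) (ν : Measure Y) (z : ℕ × ℕ → X) (m : ℕ) : Measure X :=
  (ν.restrict (ball o (m + 1))).map (x.transport z m)

theorem Nets.approxMeasure_apply (x : Nets Y o N) (ν : Measure Y) (z : ℕ × ℕ → X) (m : ℕ)
    {A : Set X} (hA : MeasurableSet A) :
    x.approxMeasure ν z m A = ν (x.transport z m ⁻¹' A ∩ ball o (m + 1)) := by
  rw [approxMeasure, Measure.map_apply (x.measurable_transport z m) hA,
    Measure.restrict_apply (x.measurable_transport z m hA)]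

theorem Nets.le_approxMeasure_image (x : Nets Y o N) (ν : Measure Y) (z : ℕ × ℕ → X) {m : ℕ}
    {B : Set Y} (hB : B ⊆ ball o (m + 1)) : ν B ≤ x.approxMeasure ν z m (x.transport z m '' B) := by
  refine le_trans ?_ (Measure.le_map_apply (x.measurable_transport z m).aemeasurable _)
  rw [← Measure.restrict_eq_self _ hB]
  exact measure_mono (subset_preimage_image _ _)

end ApproxMeasure

section Gluing

variable {X Y Z : Type*} [MetricSpace X] [MetricSpace Y] [MetricSpace Z] [MeasurableSpace Y] {o : Y}
  {N : ℕ → ℕ} {z : ℕ × ℕ → X} {x : Nets Y o N} {m : ℕ} {o' : X} {ψ : X → Z} {ψ' : Y → Z}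

theorem IsGluing.dist_le_dist_transport (h : IsGluing z x m o' ψ ψ') (a : X) {y : Y}
    (hy : dist y o < m + 1) :
    dist (ψ a) (ψ' y) ≤ dist a (x.transport z m y) + 2 * (1 / ((m : ℝ) + 1)) := by
  have htriangle := dist_triangle4_right (ψ a) (ψ' y) (ψ (x.transport z m y))
    (ψ' (x.pt (m, x.index m y)))
  rw [h.isometry.dist_eq, h.isometry'.dist_eq] at htriangle
  have hglue := h.dist_le _ (x.index_le m y hy)
  have hindex := x.dist_index_le m y hy
  unfold Nets.transport at htriangle ⊢
  linarith

theorem IsGluing.dist_root_le (h : IsGluing z x m o' ψ ψ') :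
    dist (ψ o') (ψ' o) ≤ 1 / ((m : ℝ) + 1) := by
  simpa only [h.apply_zero, x.pt_zero] using h.dist_le 0 (Nat.zero_le _)

theorem IsGluing.abs_dist_transport_sub_le (h : IsGluing z x m o' ψ ψ') {y : Y}
    (hy : dist y o < m + 1) :
    |dist (x.transport z m y) o' - dist y o| ≤ 3 * (1 / ((m : ℝ) + 1)) := by
  have htransport := h.dist_le_dist_transport (x.transport z m y) hy
  rw [dist_self, zero_add] at htransport
  rw [← h.isometry.dist_eq, ← h.isometry'.dist_eq, ← Real.dist_eq]
  linarith [dist_dist_dist_le (ψ (x.transport z m y)) (ψ o') (ψ' y) (ψ' o), h.dist_root_le]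

theorem IsGluing.approxMeasure_closedBall_le [MeasurableSpace X] [OpensMeasurableSpace X]
    (h : IsGluing z x m o' ψ ψ') (ν : Measure Y) (r : ℝ) :
    x.approxMeasure ν z m (closedBall o' r) ≤ ν (closedBall o (r + 3)) := by
  rw [x.approxMeasure_apply ν z m measurableSet_closedBall]
  refine measure_mono fun y ⟨hyr, hym⟩ => ?_
  have habs := abs_le.1 (h.abs_dist_transport_sub_le hym)
  have hm : 1 / ((m : ℝ) + 1) ≤ 1 := Nat.one_div_le_one_div (Nat.zero_le m) |>.trans (by simp)
  have hyr : dist (x.transport z m y) o' ≤ r := hyr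
  exact mem_closedBall.2 (by linarith)

end Gluing

namespace IsGluing

open RootedSpace

variable {M : Type v} {T T' : RootedSpace.{u, v} M} {N : ℕ → ℕ} {z : ℕ × ℕ → T.X}
  {x : Nets T'.X T'.ρ N} {m : ℕ} {Z : Type u} [MetricSpace Z] {ψ : T.X → Z} {ψ' : T'.X → Z}
  {θ R : ℝ}

theorem closeInto (h : IsGluing z x m T.ρ ψ ψ') (hRm : R ≤ m) (hθm : 1 / ((m : ℝ) + 1) ≤ θ / 8)
    (hμ : ∀ A ⊆ T.rootBall R,
      T.μ A ≤ x.approxMeasure T'.μ z m (thickening (θ / 2) A) + ENNReal.ofReal (θ / 2)) :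
    CloseInto T T' ψ ψ' θ R where
  isometry := h.isometry
  isometry' := h.isometry'
  dist_root_le := by
    linarith [h.dist_root_le, Nat.one_div_pos_of_nat (α := ℝ) (n := m)]
  exists_dist_le a ha := by
    obtain ⟨j, hj, haj⟩ := h.exists_dist_le a (by linarith [mem_closedBall.1 ha])
    refine ⟨x.pt (m, j), ?_⟩
    rw [← h.isometry.dist_eq] at haj
    linarith [dist_triangle (ψ a) (ψ (z (m, j))) (ψ' (x.pt (m, j))), h.dist_le j hj,
      Nat.one_div_pos_of_nat (α := ℝ) (n := m)]
  measure_le A hA := by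
    have hm : 0 < 1 / ((m : ℝ) + 1) := Nat.one_div_pos_of_nat
    refine (hμ A hA).trans (add_le_add ?_ (ENNReal.ofReal_le_ofReal (by linarith)))
    rw [x.approxMeasure_apply _ _ _ isOpen_thickening.measurableSet]
    refine measure_mono fun y ⟨hyA, hym⟩ => ?_
    obtain ⟨a, ha, hya⟩ := mem_thickening_iff.1 hyA
    refine mem_thickening_iff.2 ⟨ψ a, mem_image_of_mem ψ ha, ?_⟩
    rw [dist_comm]
    linarith [h.dist_le_dist_transport a hym, dist_comm a (x.transport z m y)]

theorem closeInto_symm (h : IsGluing z x m T.ρ ψ ψ') (hRm : R ≤ m)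
    (hθm : 1 / ((m : ℝ) + 1) ≤ θ / 8) (hθ : θ ≤ 1)
    (hμ : ∀ A ⊆ T.rootBall (R + 1),
      x.approxMeasure T'.μ z m A ≤ T.μ (thickening (θ / 2) A) + ENNReal.ofReal (θ / 2)) :
    CloseInto T' T ψ' ψ θ R where
  isometry := h.isometry'
  isometry' := h.isometry
  dist_root_le := by
    rw [dist_comm]
    linarith [h.dist_root_le, Nat.one_div_pos_of_nat (α := ℝ) (n := m)]
  exists_dist_le y hy := by
    have hdist := h.dist_le_dist_transport (x.transport z m y) (y := y)
      (by linarith [mem_closedBall.1 hy])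
    rw [dist_self, dist_comm] at hdist
    exact ⟨_, by linarith [Nat.one_div_pos_of_nat (α := ℝ) (n := m)]⟩
  measure_le B hB := by
    have hm : 0 < 1 / ((m : ℝ) + 1) := Nat.one_div_pos_of_nat
    have hBm : B ⊆ ball T'.ρ (m + 1) := hB.trans (closedBall_subset_ball (by linarith))
    have htransport : x.transport z m '' B ⊆ T.rootBall (R + 1) := by
      rintro _ ⟨y, hy, rfl⟩
      have hyR : dist y T'.ρ ≤ R := hB hy
      have habs := abs_le.1 (h.abs_dist_transport_sub_le (hBm hy))
      exact mem_closedBall.2 (by linarith)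
    refine (x.le_approxMeasure_image T'.μ z hBm).trans ((hμ _ htransport).trans
      (add_le_add (measure_mono fun a ha => ?_) (ENNReal.ofReal_le_ofReal (by linarith))))
    obtain ⟨_, ⟨y, hy, rfl⟩, hay⟩ := mem_thickening_iff.1 ha
    refine mem_thickening_iff.2 ⟨ψ' y, mem_image_of_mem ψ' hy, ?_⟩
    linarith [h.dist_le_dist_transport a (hBm hy)]

theorem dist_φ_le [MetricSpace M] (h : IsGluing z x m T.ρ ψ ψ') (hRm : R ≤ m)
    (hθm : 1 / ((m : ℝ) + 1) ≤ θ / 8) (hθ : θ ≤ 1) {η δ : ℝ} (hθδ : 4 * θ < δ)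
    (hφ : ∀ j ≤ N m, dist (T.φ (z (m, j))) (T'.φ (x.pt (m, j))) ≤ η / 3)
    (hT : ∀ a ∈ T.rootBall (R + 1), ∀ c ∈ T.rootBall (R + 1), dist a c < δ →
      dist (T.φ a) (T.φ c) ≤ η / 3)
    (hT' : ∀ y ∈ ball T'.ρ (R + 5), ∀ w ∈ ball T'.ρ (R + 5), dist y w < δ →
      dist (T'.φ y) (T'.φ w) ≤ η / 3)
    {a : T.X} (ha : a ∈ T.rootBall R) {y : T'.X} (hy : y ∈ T'.rootBall R)
    (hay : dist (ψ a) (ψ' y) ≤ 3 * θ) : dist (T.φ a) (T'.φ y) ≤ η := by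
  have hm : 0 < 1 / ((m : ℝ) + 1) := Nat.one_div_pos_of_nat
  have ha' : dist a T.ρ ≤ R := ha
  have hy' : dist y T'.ρ ≤ R := hy
  obtain ⟨j, hj, haj⟩ := h.exists_dist_le a (by linarith)
  have hjy : dist (x.pt (m, j)) y ≤ 4 * θ := by
    rw [← h.isometry.dist_eq] at haj
    rw [← h.isometry'.dist_eq]
    linarith [dist_triangle4_left (ψ (z (m, j))) (ψ a) (ψ' (x.pt (m, j))) (ψ' y), h.dist_le j hj,
      dist_comm (ψ a) (ψ (z (m, j)))]
  have hleft : dist (T.φ a) (T.φ (z (m, j))) ≤ η / 3 := by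
    refine hT a (rootBall_subset_rootBall (by linarith) ha) _ (mem_closedBall.2 ?_) (by linarith)
    linarith [dist_triangle_left (z (m, j)) T.ρ a]
  have hright : dist (T'.φ (x.pt (m, j))) (T'.φ y) ≤ η / 3 := by
    refine hT' _ (mem_ball.2 ?_) y (mem_ball.2 (by linarith)) (by linarith)
    linarith [dist_triangle (x.pt (m, j)) y T'.ρ]
  linarith [dist_triangle4 (T.φ a) (T.φ (z (m, j))) (T'.φ (x.pt (m, j))) (T'.φ y), hφ j hj]

theorem close [MetricSpace M] (h : IsGluing z x m T.ρ ψ ψ') (hRm : R ≤ m)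
    (hθm : 1 / ((m : ℝ) + 1) ≤ θ / 8) {η δ : ℝ} (hθη : θ ≤ η) (hθ : θ ≤ 1) (hθδ : 4 * θ < δ)
    (hμ : ∀ A ⊆ T.rootBall (R + 1),
      x.approxMeasure T'.μ z m A ≤ T.μ (thickening (θ / 2) A) + ENNReal.ofReal (θ / 2) ∧
      T.μ A ≤ x.approxMeasure T'.μ z m (thickening (θ / 2) A) + ENNReal.ofReal (θ / 2))
    (hφ : ∀ j ≤ N m, dist (T.φ (z (m, j))) (T'.φ (x.pt (m, j))) ≤ η / 3)
    (hT : ∀ a ∈ T.rootBall (R + 1), ∀ c ∈ T.rootBall (R + 1), dist a c < δ →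
      dist (T.φ a) (T.φ c) ≤ η / 3)
    (hT' : ∀ y ∈ ball T'.ρ (R + 5), ∀ w ∈ ball T'.ρ (R + 5), dist y w < δ →
      dist (T'.φ y) (T'.φ w) ≤ η / 3) : T.Close T' η R :=
  ⟨θ, hθη, Z, inferInstance, ψ, ψ',
    h.closeInto hRm hθm fun A hA => (hμ A (hA.trans (rootBall_subset_rootBall (by linarith)))).2,
    h.closeInto_symm hRm hθm hθ fun A hA => (hμ A hA).1,
    fun _ ha _ hy hay => h.dist_φ_le hRm hθm hθ hθδ hφ hT hT' ha hy hay⟩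

end IsGluing

theorem HasBetween.dist_map_le {Y : Type u} [MetricSpace Y] (hY : HasBetween Y) {M : Type*}
    [MetricSpace M] {φ : Y → M} {o : Y} {R δ η : ℝ} (hδ : 0 < δ)
    (hφ : ∀ y ∈ ball o R, ∀ w ∈ ball o R, dist y w < δ → dist (φ y) (φ w) ≤ η) (n : ℕ) :
    ∀ y ∈ ball o R, dist y o ≤ n * (δ / 2) → dist (φ y) (φ o) ≤ n * η := by
  induction n with
  | zero =>
    intro y _ hy
    obtain rfl : y = o := dist_le_zero.1 (by simpa using hy)
    simp
  | succ n ih =>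
    intro y hyR hy
    obtain ⟨w, hyw, hwo⟩ := hY.exists_dist_le y o (half_pos hδ).le
    push_cast at hy ⊢
    have hwn : dist w o ≤ n * (δ / 2) := hwo.trans (max_le (by linarith) (by positivity))
    have hwR : w ∈ ball o R :=
      (hwo.trans (max_le (by linarith) dist_nonneg)).trans_lt (mem_ball.1 hyR)
    linarith [dist_triangle (φ y) (φ w) (φ o), hφ y hyR w hwR (by linarith), ih w hwR hwn]

theorem RootedSpace.Obeys.isFiniteMeasure_approxMeasure {M : Type v} [MetricSpace M]
    {T : RootedSpace.{u, v} M} {b : TreeBounds M} (h : T.Obeys b) (x : Nets T.X T.ρ b.N)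
    {X : Type*} [MeasurableSpace X] (z : ℕ × ℕ → X) (m : ℕ) :
    IsFiniteMeasure (x.approxMeasure T.μ z m) := by
  have hball : T.μ (ball T.ρ (m + 1)) < ∞ :=
    (measure_mono ball_subset_closedBall).trans_lt
      ((h.measure_rootBall_le (m + 1) (m + 1) (by push_cast; linarith)).trans_lt
        ENNReal.coe_lt_top)
  have := isFiniteMeasure_restrict.2 hball.ne
  exact Measure.isFiniteMeasure_map _ _

theorem exists_ultrafilter_le_curry {I : Type*} (F : Ultrafilter I) :
    ∃ G : Ultrafilter (ℕ × I), (G : Filter (ℕ × I)) ≤ curry atTop (F : Filter I) ∧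
      G.map Prod.snd = F := by
  have hne : (curry (atTop : Filter ℕ) (F : Filter I)).NeBot := by
    refine ⟨fun hbot => ?_⟩
    have hfalse : ∀ᶠ _ in curry (atTop : Filter ℕ) (F : Filter I), False := by simp [hbot]
    exact (eventually_curry_iff.1 hfalse).exists.elim fun _ hF => hF.exists.elim fun _ => id
  refine ⟨Ultrafilter.of _, Ultrafilter.of_le _, Ultrafilter.coe_le_coe.1 ?_⟩
  exact tendsto_snd.mono_left ((Ultrafilter.of_le _).trans curry_le_prod)

theorem eventually_forall_dist_lt_of_le_curry {I M : Type*} [MetricSpace M] {F : Ultrafilter I}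
    {G : Ultrafilter (ℕ × I)} (hG : (G : Filter (ℕ × I)) ≤ curry atTop (F : Filter I))
    {f : I → ℕ × ℕ → M} {g : ℕ × ℕ → M} (hfg : ∀ p, Tendsto (fun i => f i p) F (𝓝 (g p)))
    (N : ℕ → ℕ) {η : ℝ} (hη : 0 < η) :
    ∀ᶠ k : ℕ × I in G, ∀ j ≤ N k.1, dist (g (k.1, j)) (f k.2 (k.1, j)) < η := by
  refine hG (eventually_curry_iff.2 (Eventually.of_forall fun m => ?_))
  refine (eventually_all_finite (finite_Iic (N m))).2 fun j _ => ?_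
  have hlim := (tendsto_const_nhds (x := g (m, j))).dist (hfg (m, j))
  rw [dist_self] at hlim
  exact hlim.eventually_lt_const hη

namespace IsNetLimit

open RootedSpace

variable {I : Type*} {F : Ultrafilter I} {G : Ultrafilter (ℕ × I)} {M : Type v} [MetricSpace M]
  {S : I → SpatialTree.{u, v} M} {b : TreeBounds M} {x : ∀ i, Nets (S i).X (S i).ρ b.N}
  {X : Type u} [MetricSpace X] {z : ℕ × ℕ → X}

theorem exists_limit_map_of_obeys [ProperSpace M] (h : IsNetLimit F x z)
    (hS : ∀ i, (S i).Obeys b) :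
    ∃ Φ : X → M, Continuous Φ ∧ ∀ p, Tendsto (fun i => (S i).φ ((x i).pt p)) F (𝓝 (Φ (z p))) := by
  refine h.exists_limit_map (fun p => ?_) fun m => ⟨b.δ m, b.δ_pos m, fun i => (hS i).dist_φ_le m⟩
  obtain ⟨n, hn⟩ := exists_nat_gt ((p.1 + 1) / (b.δ p.1 / 2))
  refine ⟨_, isCompact_closedBall b.m₀ (n * (1 / ((p.1 : ℝ) + 1)) + b.R₀), fun i => ?_⟩
  have hpn : dist ((x i).pt p) (S i).ρ ≤ n * (b.δ p.1 / 2) :=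
    ((x i).dist_pt_lt p).le.trans ((div_lt_iff₀ (half_pos (b.δ_pos _))).1 hn).le
  exact (dist_triangle _ ((S i).φ (S i).ρ) _).trans (add_le_add
    ((S i).realTree.hasBetween.dist_map_le (b.δ_pos _) ((hS i).dist_φ_le p.1) n _
      ((x i).dist_pt_lt p) hpn) (hS i).dist_φ_root_le)

theorem eventually_exists_isGluing_of_le_curry (h : IsNetLimit F x z)
    (hG : (G : Filter (ℕ × I)) ≤ curry atTop (F : Filter I)) :
    ∀ᶠ k : ℕ × I in G, ∃ (Z : Type u) (_ : MetricSpace Z) (ψ : X → Z) (ψ' : (S k.2).X → Z),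
      IsGluing z (x k.2) k.1 (z (0, 0)) ψ ψ' :=
  hG (eventually_curry_iff.2 (Eventually.of_forall h.eventually_exists_isGluing))

variable [CompleteSpace X] [MeasurableSpace X] [BorelSpace X]

theorem exists_tendstoVague_approxMeasure (h : IsNetLimit F x z) (hS : ∀ i, (S i).Obeys b)
    (hG : (G : Filter (ℕ × I)) ≤ curry atTop (F : Filter I)) :
    ∃ μ : Measure X, IsFiniteMeasureOnCompacts μ ∧
      TendstoVague (fun k : ℕ × I => (x k.2).approxMeasure (S k.2).μ z k.1) G μ := by
  have := h.properSpace
  have (k : ℕ × I) := (hS k.2).isFiniteMeasure_approxMeasure (x k.2) z k.1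
  refine exists_tendstoVague G _ fun K hK => ?_
  obtain ⟨r, hr⟩ := hK.isBounded.subset_closedBall (z (0, 0))
  refine ⟨b.C ⌈r + 3⌉₊, ?_⟩
  filter_upwards [h.eventually_exists_isGluing_of_le_curry hG] with k ⟨Z, _, ψ, ψ', hψ⟩
  calc (x k.2).approxMeasure (S k.2).μ z k.1 K
      ≤ (x k.2).approxMeasure (S k.2).μ z k.1 (closedBall (z (0, 0)) r) := measure_mono hr
    _ ≤ (S k.2).μ ((S k.2).rootBall (r + 3)) := hψ.approxMeasure_closedBall_le _ r
    _ ≤ b.C ⌈r + 3⌉₊ := (hS k.2).measure_rootBall_le _ _ ((Nat.le_ceil _).trans_lt (lt_add_one _))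

/-- The limit of the trees `S i`, with a given measure and a given map into `M`. -/
def tree (h : IsNetLimit F x z) (μ : Measure X) [IsFiniteMeasureOnCompacts μ] {Φ : X → M}
    (hΦ : Continuous Φ) : SpatialTree.{u, v} M :=
  have := h.properSpace
  { X := X
    μ := μ
    φ := Φ
    ρ := z (0, 0)
    realTree := (h.fourPoint fun i => (S i).realTree.fourPoint).isRealTree
      (h.hasBetween fun i => (S i).realTree.hasBetween)
    complete := inferInstance
    locallyCompact := inferInstance
    locallyFinite := inferInstance
    continuous_φ := hΦ }

theorem eventually_close (h : IsNetLimit F x z) (hS : ∀ i, (S i).Obeys b)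
    (hG : (G : Filter (ℕ × I)) ≤ curry atTop (F : Filter I))
    {μ : Measure X} [IsFiniteMeasureOnCompacts μ]
    (hlim : TendstoVague (fun k : ℕ × I => (x k.2).approxMeasure (S k.2).μ z k.1) G μ)
    {Φ : X → M} (hΦ : Continuous Φ)
    (hΦlim : ∀ p, Tendsto (fun i => (S i).φ ((x i).pt p)) F (𝓝 (Φ (z p)))) {η : ℝ} (hη : 0 < η)
    (R : ℝ) : ∀ᶠ k : ℕ × I in G, (h.tree μ hΦ).Close (S k.2).toRootedSpace η R := by
  have := h.properSpace
  have (k : ℕ × I) := (hS k.2).isFiniteMeasure_approxMeasure (x k.2) z k.1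
  obtain ⟨δ', hδ', hunif⟩ := Metric.uniformContinuousOn_iff.1
    ((isCompact_closedBall (z (0, 0)) (R + 1)).uniformContinuousOn_of_continuous hΦ.continuousOn)
    (η / 3) (by positivity)
  obtain ⟨m₁, hm₁R, hm₁η⟩ := exists_nat_gt_and_one_div_lt (R + 5) (by positivity : 0 < η / 3)
  obtain ⟨δ, hδ, hδδ', hδb⟩ : ∃ δ > 0, δ ≤ δ' ∧ δ ≤ b.δ m₁ :=
    ⟨min δ' (b.δ m₁), lt_min hδ' (b.δ_pos m₁), min_le_left _ _, min_le_right _ _⟩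
  obtain ⟨θ, hθ, hθη, hθ1, hθδ⟩ : ∃ θ > 0, θ ≤ η ∧ θ ≤ 1 ∧ 4 * θ < δ :=
    ⟨min (min η 1) (δ / 5), by positivity, (min_le_left _ _).trans (min_le_left _ _),
      (min_le_left _ _).trans (min_le_right _ _), by linarith [min_le_right (min η 1) (δ / 5)]⟩
  obtain ⟨m₂, hm₂R, hm₂θ⟩ := exists_nat_gt_and_one_div_lt R (by positivity : 0 < θ / 8)
  have hlarge : ∀ᶠ k : ℕ × I in G, m₂ ≤ k.1 := hG <| eventually_curry_iff.2 <|
    (eventually_ge_atTop m₂).mono fun _ hm => Eventually.of_forall fun _ => hm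
  filter_upwards [hlarge, h.eventually_exists_isGluing_of_le_curry hG,
    eventually_forall_dist_lt_of_le_curry hG hΦlim b.N (by positivity : 0 < η / 3),
    hlim.eventually_measure_le_thickening (isCompact_closedBall (z (0, 0)) (R + 1)) (half_pos hθ)]
    with k hkm ⟨Z, _, ψ, ψ', hψ⟩ hkφ hkμ
  have hRk : R ≤ k.1 := hm₂R.le.trans (Nat.cast_le.2 hkm)
  have hθk : 1 / ((k.1 : ℝ) + 1) ≤ θ / 8 := (Nat.one_div_le_one_div hkm).trans hm₂θ.le
  have hS_unif : ∀ y ∈ ball (S k.2).ρ (R + 5), ∀ w ∈ ball (S k.2).ρ (R + 5), dist y w < δ →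
      dist ((S k.2).φ y) ((S k.2).φ w) ≤ η / 3 := fun y hy w hw hyw =>
    ((hS k.2).dist_φ_le m₁ y (ball_subset_ball (by linarith) hy) w
      (ball_subset_ball (by linarith) hw) (hyw.trans_le hδb)).trans hm₁η.le
  exact IsGluing.close (T := (h.tree μ hΦ).toRootedSpace) hψ hRk hθk hθη hθ1 hθδ hkμ
    (fun j hj => (hkφ j hj).le)
    (fun a ha c hc hac => (hunif a ha c hc (hac.trans_le hδδ')).le) hS_unif

end IsNetLimit

theorem exists_tendsto_delta {M : Type v} [MetricSpace M] [ProperSpace M] {I : Type*}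
    (F : Ultrafilter I) (S : I → SpatialTree.{u, v} M) {b : TreeBounds M}
    (hS : ∀ i, (S i).Obeys b) :
    ∃ T : SpatialTree.{u, v} M, Tendsto (fun i => SpatialTree.delta T (S i)) F (𝓝 0) := by
  obtain ⟨x⟩ := Classical.nonempty_pi.2 fun i => nonempty_nets (hS i).packingNumber_le
  obtain ⟨X, _, _, z, h⟩ := exists_isNetLimit F x
  let _ : MeasurableSpace X := borel X
  have : BorelSpace X := ⟨rfl⟩
  obtain ⟨Φ, hΦ, hΦlim⟩ := h.exists_limit_map_of_obeys hS
  obtain ⟨G, hG, rfl⟩ := exists_ultrafilter_le_curry F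
  obtain ⟨μ, hμ, hlim⟩ := h.exists_tendstoVague_approxMeasure hS hG
  have : ProperSpace (h.tree μ hΦ).X := h.properSpace
  exact ⟨h.tree μ hΦ, tendsto_map'_iff.2 <| SpatialTree.tendsto_delta_of_close _ fun η hη R =>
    h.eventually_close hS hG hlim hΦ hΦlim hη R⟩

end Convergence

namespace SpatialTree

open Filter Topology

variable {M : Type v} [MetricSpace M]

theorem tendsto_nhds_of_tendsto_delta {ι : Type*} {l : Filter ι} {S : ι → SpatialTree.{u, v} M}
    {T : SpatialTree.{u, v} M} (h : Tendsto (fun i => delta T (S i)) l (𝓝 0)) :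
    Tendsto S l (𝓝 T) := by
  refine tendsto_nhds.2 fun U hU hTU => ?_
  obtain ⟨ε, hε, hUε⟩ := hU T hTU
  exact (h.eventually_lt_const hε).mono fun i hi => hUε (S i) hi

theorem isCompact_obeys [ProperSpace M] (b : TreeBounds M) :
    IsCompact {T : SpatialTree.{u, v} M | T.Obeys b} := by
  refine isCompact_iff_isCompact_univ.2 (isCompact_iff_ultrafilter_le_nhds.2 fun F _ => ?_)
  obtain ⟨T, hT⟩ := exists_tendsto_delta F (fun T => T.1) fun T => T.2
  have hlim : Tendsto Subtype.val (F : Filter {T | T.Obeys b}) (𝓝 T) :=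
    tendsto_nhds_of_tendsto_delta hT
  have hTb : T.Obeys b := (isClosed_obeys b).mem_of_tendsto hlim (Eventually.of_forall Subtype.prop)
  exact ⟨⟨T, hTb⟩, mem_univ _, tendsto_subtype_rng.2 hlim⟩

theorem isClosed_image_obeys (b : TreeBounds M) :
    IsClosed ((fun T => (⟦T⟧ : SpatialTreeSpace.{u, v} M)) '' {T | T.Obeys b}) := by
  refine isQuotientMap_quotient_mk'.isClosed_preimage.1 ?_
  convert isClosed_obeys b
  refine Subset.antisymm ?_ (subset_preimage_image _ _)
  rintro T ⟨T', hT', hTT'⟩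
  exact Equivalent.obeys (Setoid.symm (Quotient.exact hTT')) hT'

end SpatialTree

theorem lemma3p5 {M : Type v} [MetricSpace M] [ProperSpace M]
    (A : Set (SpatialTree.{u, v} M))
    (cover : ∀ r : ℝ, 0 < r → ∀ ε : ℝ≥0, 0 < ε → ∃ N : ℕ, ∀ T ∈ A,
      ∃ s : Finset T.X, s.card < N ∧ IsCover ε (T.rootBall r) (s : Set T.X))
    (mass : ∀ r : ℝ, 0 < r → (⨆ T ∈ A, T.μ (T.rootBall r)) < ∞)
    (root : Bornology.IsBounded {m : M | ∃ T ∈ A, m = T.φ T.ρ})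
    (equi : ∀ r : ℝ, 0 < r → ∀ ε : ℝ≥0, 0 < ε → ∃ δ : ℝ, 0 < δ ∧
      (⨆ T ∈ A, ⨆ (x ∈ T.rootBall r) (y ∈ T.rootBall r) (_ : dist x y ≤ δ),
        edist (T.φ x) (T.φ y)) < ε) :
    IsCompact (closure
      ((fun T => (⟦T⟧ : SpatialTreeSpace.{u, v} M)) '' A)) := by
  rcases A.eq_empty_or_nonempty with rfl | hA
  · simp
  obtain ⟨b, hb⟩ := SpatialTree.exists_forall_obeys A hA cover mass root equi
  have hcompact := (SpatialTree.isCompact_obeys b).image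
    (continuous_quotient_mk' (s := SpatialTree.setoid))
  exact hcompact.of_isClosed_subset isClosed_closure
    (closure_minimal (image_mono hb) (SpatialTree.isClosed_image_obeys b))

end
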